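/- Let $p$ be a prime, $k$ a field of characteristic $p$, and $H=k[X]/(X^p)$ the Hopf algebra with $\Delta(X)=X\otimes 1+1\otimes X$ and $\varepsilon(X)=0$, graded with $X$ in degree $1$. Let $\mathcal H'$ be the stable category of finite-dimensional $\mathbb Z$-graded $H$-modules, i.e. the quotient of the category of finite-dimensional $\mathbb Z$-graded $H$-modules and degree-preserving $H$-linear maps by the ideal of morphisms that factor through a projective module. With $\Lambda=X^{p-1}$ and $M\{j\}$ the grading shift of $M$ upward by $j$, its translation functor is $TM=(H/k\Lambda)\{1-p\}\otimes_k M$, and its distinguished triangles are the sextuples $X\to Y\to Z\to TX$ isomorphic in $\mathcal H'$ to a standard one $X\xrightarrow{u}Y\to C_u\to TX$, where $u$ is a morphism of graded modules, $C_u$ is the pushout of $u$ and the embedding $X\to H\{1-p\}\otimes_k X$, $x\mapsto \Lambda\otimes x$, and $C_u\to TX$ is induced by the quotient map $H\{1-p\}\otimes_k X\to TX$ and by $0\colon Y\to TX$. Let $K(\mathcal H')$ be the Grothendieck group: the abelian group with generators $[M]$ for the objects $M$ of $\mathcal H'$ and relations $[Y]=[X]+[Z]$ for the distinguished triangles $X\to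 Y\to Z\to TX$. Then $K(\mathcal H')$ is naturally isomorphic to the ring $R_p=\mathbb Z[q]/(1+q+\dots+q^{p-1})$, with multiplication by $q$ corresponding to the grading shift. Precisely, there is a unique isomorphism of abelian groups $\varphi\colon K(\mathcal H')\to R_p$ such that $\varphi([\mathbf 1])=1$, where $\mathbf 1=k$ is the trivial module in degree $0$, and, for all finite-dimensional graded $H$-modules $M$ and $N$, $\varphi([M\otimes_k N])=\varphi([M])\,\varphi([N])$ and $\varphi([M\{1\}])=q\,\varphi([M])$. -/

import Mathlib

open CategoryTheory
open scoped TensorProduct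

universe u

noncomputable section

namespace KStable

/-! ### Gradings of vector spaces -/

section Gradings

variable {k : Type u} [Field k] {V W : Type u} [AddCommGroup V] [Module k V]
  [AddCommGroup W] [Module k W]

/-- Criterion for a family of subspaces to be a grading: it spans, and there is a linear map
`v ↦ ∑ vₙ tⁿ` sending every `v` in the `n`-th subspace to `v tⁿ`. -/
theorem isInternal_of_coaction (A : ℤ → Submodule k V) (hs : iSup A = ⊤)
    (d : V →ₗ[k] (ℤ →₀ V)) (hd : ∀ n, ∀ v ∈ A n, d v = Finsupp.single n v) :
    DirectSum.IsInternal A := by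
  constructor
  · have key : ∀ x : DirectSum ℤ (fun i => A i), ∀ n : ℤ,
        d (DirectSum.coeAddMonoidHom A x) n = (x n : V) := by
      intro x n
      induction x using DirectSum.induction_on with
      | zero => simp
      | of i v =>
        rw [DirectSum.coeAddMonoidHom_of, hd i _ v.2, Finsupp.single_apply,
          DirectSum.coe_of_apply]
        split_ifs <;> simp
      | add x y hx hy => simp [map_add, hx, hy]
    intro x y hxy
    ext n
    rw [← key x n, ← key y n, hxy]
  · intro v
    have hv : v ∈ iSup A := hs ▸ Submodule.mem_top
    induction hv using Submodule.iSup_induction' with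
    | mem i v hv => exact ⟨DirectSum.of (fun i => A i) i ⟨v, hv⟩, by simp⟩
    | zero => exact ⟨0, by simp⟩
    | add x y _ _ hx hy =>
      obtain ⟨a, ha⟩ := hx
      obtain ⟨b, hb⟩ := hy
      exact ⟨a + b, by rw [map_add, ha, hb]⟩

theorem exists_coaction {A : ℤ → Submodule k V} (h : DirectSum.IsInternal A) :
    ∃ d : V →ₗ[k] (ℤ →₀ V), (∀ n, ∀ v ∈ A n, d v = Finsupp.single n v) ∧
      ∀ v n, d v n ∈ A n := by
  let e := LinearEquiv.ofBijective (DirectSum.coeLinearMap A) h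
  obtain ⟨s, hs1⟩ : ∃ s : DirectSum ℤ (fun i => A i) →ₗ[k] (ℤ →₀ V),
      ∀ i (v : A i), s (DirectSum.lof k ℤ (fun i => A i) i v) = Finsupp.single i (v : V) :=
    ⟨DirectSum.toModule k ℤ (ℤ →₀ V) (fun i => (Finsupp.lsingle i : V →ₗ[k] _) ∘ₗ (A i).subtype),
      fun i v => by rw [DirectSum.toModule_lof]; rfl⟩
  have hs : ∀ (x : DirectSum ℤ (fun i => A i)) (n : ℤ), s x n = (x n : V) := by
    intro x n
    induction x using DirectSum.induction_on with
    | zero => simp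
    | of i v =>
      rw [← DirectSum.lof_eq_of k, hs1, Finsupp.single_apply, DirectSum.lof_eq_of,
        DirectSum.coe_of_apply]
      split_ifs <;> simp
    | add x y hx hy => simp [map_add, hx, hy]
  refine ⟨s.comp e.symm.toLinearMap, ?_, ?_⟩
  · intro n v hv
    have he : e (DirectSum.lof k ℤ (fun i => A i) n ⟨v, hv⟩) = v :=
      DirectSum.coeLinearMap_lof A n ⟨v, hv⟩
    have hes : e.symm v = DirectSum.lof k ℤ (fun i => A i) n ⟨v, hv⟩ := by
      rw [LinearEquiv.symm_apply_eq, he]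
    rw [LinearMap.comp_apply, LinearEquiv.coe_coe, hes, hs1]
  · intro v n
    rw [LinearMap.comp_apply, hs]
    exact Subtype.property _

/-- The total grading of a tensor product: degree `n` is spanned by the `v ⊗ w` with
`deg v + deg w = n`. -/
def tensorDeg (A : ℤ → Submodule k V) (B : ℤ → Submodule k W) (n : ℤ) :
    Submodule k (V ⊗[k] W) :=
  Submodule.span k {t | ∃ i j : ℤ, i + j = n ∧ ∃ v ∈ A i, ∃ w ∈ B j, v ⊗ₜ[k] w = t}

theorem tmul_mem_tensorDeg {A : ℤ → Submodule k V} {B : ℤ → Submodule k W} {i j n : ℤ}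
    (h : i + j = n) {v : V} (hv : v ∈ A i) {w : W} (hw : w ∈ B j) :
    v ⊗ₜ[k] w ∈ tensorDeg A B n :=
  Submodule.subset_span ⟨i, j, h, v, hv, w, hw, rfl⟩

theorem isInternal_tensorDeg {A : ℤ → Submodule k V} {B : ℤ → Submodule k W}
    (hA : DirectSum.IsInternal A) (hB : DirectSum.IsInternal B) :
    DirectSum.IsInternal (tensorDeg A B) := by
  obtain ⟨d, hd, -⟩ := exists_coaction hA
  obtain ⟨e, he, -⟩ := exists_coaction hB
  refine isInternal_of_coaction _ ?_
    ((Finsupp.lmapDomain (V ⊗[k] W) k (fun x : ℤ × ℤ => x.1 + x.2)).comp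
      ((finsuppTensorFinsupp k k V W ℤ ℤ).toLinearMap.comp (TensorProduct.map d e))) ?_
  · rw [eq_top_iff, ← TensorProduct.span_tmul_eq_top, Submodule.span_le]
    rintro _ ⟨v, w, rfl⟩
    have hv : v ∈ iSup A := hA.submodule_iSup_eq_top ▸ Submodule.mem_top
    have hw : w ∈ iSup B := hB.submodule_iSup_eq_top ▸ Submodule.mem_top
    change v ⊗ₜ[k] w ∈ iSup (tensorDeg A B)
    induction hv using Submodule.iSup_induction' with
    | mem i v hv =>
      induction hw using Submodule.iSup_induction' with
      | mem j w hw =>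
        exact Submodule.mem_iSup_of_mem (i + j) (tmul_mem_tensorDeg rfl hv hw)
      | zero => simp
      | add x y _ _ hx hy => rw [TensorProduct.tmul_add]; exact add_mem hx hy
    | zero => simp
    | add x y _ _ hx hy => rw [TensorProduct.add_tmul]; exact add_mem hx hy
  · intro n t ht
    induction ht using Submodule.span_induction with
    | mem t ht =>
      obtain ⟨i, j, rfl, v, hv, w, hw, rfl⟩ := ht
      simp [hd i v hv, he j w hw]
    | zero => simp
    | add x y _ _ hx hy => rw [map_add, hx, hy, Finsupp.single_add]
    | smul c x _ hx => rw [map_smul, hx, Finsupp.smul_single]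

/-- The image of a grading under a surjective linear map with homogeneous kernel is a grading. -/
theorem isInternal_map {A : ℤ → Submodule k V} (hA : DirectSum.IsInternal A) (f : V →ₗ[k] W)
    (hf : Function.Surjective f) (K : Set V) (hK : LinearMap.ker f = Submodule.span k K)
    (hKA : ∀ x ∈ K, ∃ n, x ∈ A n) : DirectSum.IsInternal (fun n => (A n).map f) := by
  obtain ⟨d, hd, -⟩ := exists_coaction hA
  let fd : V →ₗ[k] (ℤ →₀ W) := (Finsupp.mapRange.linearMap f).comp d
  have hker : LinearMap.ker f ≤ LinearMap.ker fd := by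
    rw [hK, Submodule.span_le]
    intro x hx
    obtain ⟨n, hn⟩ := hKA x hx
    have hfx : f x = 0 := by
      have : x ∈ LinearMap.ker f := hK ▸ Submodule.subset_span hx
      exact this
    simp [fd, hd n x hn, hfx]
  obtain ⟨g, hg⟩ := (LinearMap.exists_rightInverse_of_surjective f (LinearMap.range_eq_top.2 hf))
  have hfd : ∀ v, fd (g (f v)) = fd v := by
    intro v
    rw [← sub_eq_zero, ← map_sub]
    apply hker
    rw [LinearMap.mem_ker, map_sub, sub_eq_zero]
    exact LinearMap.congr_fun hg (f v)
  refine isInternal_of_coaction _ ?_ (fd.comp g) ?_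
  · rw [← Submodule.map_iSup, hA.submodule_iSup_eq_top, Submodule.map_top,
      LinearMap.range_eq_top.2 hf]
  · rintro n _ ⟨v, hv, rfl⟩
    rw [LinearMap.comp_apply, hfd]
    simp [fd, hd n v hv]

end Gradings

/-! ### The graded Hopf algebra `H = k[X]/(X ^ p)` -/

section HopfAlgebra

variable (k : Type u) [Field k] (p : ℕ)

/-- The algebra `H = k[X]/(X ^ p)`. -/
abbrev H : Type u := AdjoinRoot (Polynomial.X ^ p : Polynomial k)

/-- The class of `X` in `H`. -/
def xH : H k p := AdjoinRoot.root _

/-- The grading of `H`, with `X` in degree `1`. -/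
def hDeg (i : ℤ) : Submodule k (H k p) := Submodule.span k {h | ∃ n : ℕ, (n : ℤ) = i ∧ xH k p ^ n = h}

theorem xH_pow : xH k p ^ p = 0 := by
  have h := AdjoinRoot.mk_self (f := (Polynomial.X ^ p : Polynomial k))
  rwa [map_pow, AdjoinRoot.mk_X] at h

theorem xH_pow_mem (n : ℕ) : xH k p ^ n ∈ hDeg k p n := Submodule.subset_span ⟨n, rfl, rfl⟩

theorem span_xH_pow : Submodule.span k (Set.range fun n : ℕ => xH k p ^ n) = ⊤ := by
  rw [eq_top_iff]
  rintro x -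
  induction x using AdjoinRoot.induction_on with
  | ih f =>
    induction f using Polynomial.induction_on' with
    | add f g hf hg => rw [map_add]; exact add_mem hf hg
    | monomial n a =>
      rw [← Polynomial.C_mul_X_pow_eq_monomial, ← Polynomial.smul_eq_C_mul, ← AdjoinRoot.smul_mk,
        map_pow, AdjoinRoot.mk_X]
      exact Submodule.smul_mem _ _ (Submodule.subset_span ⟨n, rfl⟩)

theorem isInternal_hDeg [Fact p.Prime] : DirectSum.IsInternal (hDeg k p) := by
  let D : H k p →ₐ[k] AddMonoidAlgebra (H k p) ℤ :=
    AdjoinRoot.liftAlgHom _ (Algebra.ofId k _) (AddMonoidAlgebra.single 1 (xH k p)) (by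
      rw [Polynomial.eval₂_X_pow, AddMonoidAlgebra.single_pow, xH_pow]
      exact AddMonoidAlgebra.single_zero _)
  have hD : ∀ n : ℕ, D (xH k p ^ n) = AddMonoidAlgebra.single (n : ℤ) (xH k p ^ n) := by
    intro n
    rw [map_pow, xH, AdjoinRoot.liftAlgHom_root, AddMonoidAlgebra.single_pow]
    simp [xH]
  refine isInternal_of_coaction _ ?_
    ((AddMonoidAlgebra.coeffLinearEquiv k).toLinearMap.comp D.toLinearMap) ?_
  · rw [eq_top_iff, ← span_xH_pow, Submodule.span_le]
    rintro _ ⟨n, rfl⟩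
    exact Submodule.mem_iSup_of_mem (n : ℤ) (xH_pow_mem k p n)
  · intro n t ht
    induction ht using Submodule.span_induction with
    | mem t ht =>
      obtain ⟨m, rfl, rfl⟩ := ht
      change (D (xH k p ^ m)).coeff = _
      rw [hD]
      rfl
    | zero => simp
    | add x y _ _ hx hy => rw [map_add, hx, hy, Finsupp.single_add]
    | smul c x _ hx => rw [map_smul, hx, Finsupp.smul_single]

instance finite_H [Fact p.Prime] : Module.Finite k (H k p) :=
  (Polynomial.monic_X_pow p).finite_adjoinRoot

section Structure

variable [Fact p.Prime]

/-- The comultiplication `Δ : H → H ⊗ H` with `Δ X = X ⊗ 1 + 1 ⊗ X`. -/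
def comulH [CharP k p] : H k p →ₐ[k] H k p ⊗[k] H k p :=
  AdjoinRoot.liftAlgHom _ (Algebra.ofId k _) (xH k p ⊗ₜ 1 + 1 ⊗ₜ xH k p) (by
    obtain ⟨r, hr⟩ := exists_add_pow_prime_eq (R := H k p ⊗[k] H k p)
      (Fact.out : p.Prime)
      (xH k p ⊗ₜ[k] 1) (1 ⊗ₜ[k] xH k p)
    have h0 : (p : H k p ⊗[k] H k p) = 0 := by
      rw [← map_natCast (algebraMap k (H k p ⊗[k] H k p)), CharP.cast_eq_zero, map_zero]
    rw [Polynomial.eval₂_X_pow, hr, h0]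
    simp [xH_pow])

theorem comulH_xH [CharP k p] : comulH k p (xH k p) = xH k p ⊗ₜ 1 + 1 ⊗ₜ xH k p :=
  AdjoinRoot.liftAlgHom_root _ _ _ _

/-- The counit `ε : H → k` with `ε X = 0`. -/
def counitH : H k p →ₐ[k] k :=
  AdjoinRoot.liftAlgHom _ (Algebra.ofId k _) 0 (by
    rw [Polynomial.eval₂_X_pow, zero_pow (Fact.out : p.Prime).ne_zero])

/-- The left integral `Λ = X ^ (p - 1)` of `H`; it spans the ideal of elements killed by `X`. -/
def integralH : H k p := xH k p ^ (p - 1)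

theorem xH_mul_integralH : xH k p * integralH k p = 0 := by
  rw [integralH, ← pow_succ', Nat.sub_add_cancel (Fact.out : p.Prime).one_le, xH_pow]

end Structure

end HopfAlgebra

/-! ### The action of `H` on a tensor product -/

section Action

variable {k : Type u} [Field k] {p : ℕ}

/-- A `k`-linear map commuting with `X` is `H`-linear. -/
def linearOfX {V W : Type u} [AddCommGroup V] [Module k V] [Module (H k p) V]
    [IsScalarTower k (H k p) V] [AddCommGroup W] [Module k W] [Module (H k p) W]
    [IsScalarTower k (H k p) W] (f : V →ₗ[k] W) (hf : ∀ v, f (xH k p • v) = xH k p • f v) :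
    V →ₗ[H k p] W where
  toFun := f
  map_add' := map_add f
  map_smul' h v := by
    have hn : ∀ (n : ℕ) (v : V), f (xH k p ^ n • v) = xH k p ^ n • f v := by
      intro n
      induction n with
      | zero => simp
      | succ n ih => intro v; rw [pow_succ, mul_smul, ih, hf, mul_smul]
    have hh : h ∈ Submodule.span k (Set.range fun n : ℕ => xH k p ^ n) :=
      span_xH_pow k p ▸ Submodule.mem_top
    rw [RingHom.id_apply]
    induction hh using Submodule.span_induction with
    | mem h hh => obtain ⟨n, rfl⟩ := hh; exact hn n v
    | zero => simp
    | add a b _ _ ha hb => rw [add_smul, map_add, ha, hb, add_smul]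
    | smul c a _ ha => rw [smul_assoc, map_smul, ha, smul_assoc]

variable (V W : Type u) [AddCommGroup V] [Module k V] [Module (H k p) V]
    [IsScalarTower k (H k p) V] [AddCommGroup W] [Module k W] [Module (H k p) W]
    [IsScalarTower k (H k p) W] [Fact p.Prime] [CharP k p]

/-- The action of `H` on `V ⊗ W` through the comultiplication. -/
def tensorAction : H k p →ₐ[k] Module.End k (V ⊗[k] W) :=
  (Module.endTensorEndAlgHom (R := k) (S := k) (A := k) (M := V) (N := W)).comp
    ((Algebra.TensorProduct.map (Algebra.lsmul k k V) (Algebra.lsmul k k W)).comp (comulH k p))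

theorem tensorAction_xH (v : V) (w : W) :
    tensorAction V W (xH k p) (v ⊗ₜ w) = (xH k p • v) ⊗ₜ w + v ⊗ₜ (xH k p • w) := by
  change Module.endTensorEndAlgHom (R := k) (S := k) (A := k) (M := V) (N := W)
    (Algebra.TensorProduct.map (Algebra.lsmul k k V) (Algebra.lsmul k k W)
      (comulH k p (xH k p))) (v ⊗ₜ w) = _
  rw [comulH_xH, map_add, map_add, Algebra.TensorProduct.map_tmul, Algebra.TensorProduct.map_tmul,
    Module.endTensorEndAlgHom_apply, Module.endTensorEndAlgHom_apply]
  simp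

variable {V W} in
theorem tensorAction_mem {A : ℤ → Submodule k V} {B : ℤ → Submodule k W}
    (hA : ∀ j, ∀ v ∈ A j, xH k p • v ∈ A (1 + j)) (hB : ∀ j, ∀ v ∈ B j, xH k p • v ∈ B (1 + j))
    (n : ℤ) (t : V ⊗[k] W) (ht : t ∈ tensorDeg A B n) :
    tensorAction V W (xH k p) t ∈ tensorDeg A B (1 + n) := by
  induction ht using Submodule.span_induction with
  | mem t ht =>
    obtain ⟨i, j, rfl, v, hv, w, hw, rfl⟩ := ht
    rw [tensorAction_xH]
    exact add_mem (tmul_mem_tensorDeg (by ring) (hA _ _ hv) hw)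
      (tmul_mem_tensorDeg (by ring) hv (hB _ _ hw))
  | zero => rw [map_zero]; exact Submodule.zero_mem _
  | add a b _ _ ha hb => rw [map_add]; exact add_mem ha hb
  | smul c a _ ha => rw [map_smul]; exact Submodule.smul_mem _ _ ha

variable {V W} in
theorem tensorAction_smul (c : k) (h : H k p) (t : V ⊗[k] W) :
    tensorAction V W (c • h) t = c • tensorAction V W h t := by
  rw [map_smul, LinearMap.smul_apply]

/-- The space `V ⊗ W`, with the action of `H` through the comultiplication. -/
def DiagTensor (k : Type u) [Field k] (V W : Type u) [AddCommGroup V] [Module k V]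
    [AddCommGroup W] [Module k W] : Type u := V ⊗[k] W

instance : AddCommGroup (DiagTensor k V W) := inferInstanceAs (AddCommGroup (V ⊗[k] W))

instance : Module k (DiagTensor k V W) := inferInstanceAs (Module k (V ⊗[k] W))

instance [Module.Finite k V] [Module.Finite k W] : Module.Finite k (DiagTensor k V W) :=
  inferInstanceAs (Module.Finite k (V ⊗[k] W))

instance : Module (H k p) (DiagTensor k V W) :=
  Module.compHom (V ⊗[k] W) (tensorAction V W).toRingHom

instance : IsScalarTower k (H k p) (DiagTensor k V W) :=
  ⟨fun c h t => tensorAction_smul (V := V) (W := W) c h t⟩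

end Action

/-! ### Finite-dimensional graded `H`-modules -/

/-- Finite-dimensional `ℤ`-graded modules over the graded algebra `H`. -/
structure GMod (k : Type u) [Field k] (p : ℕ) where
  carrier : Type u
  [addCommGroup : AddCommGroup carrier]
  [moduleBase : Module k carrier]
  [moduleH : Module (H k p) carrier]
  [tower : IsScalarTower k (H k p) carrier]
  [finite : Module.Finite k carrier]
  deg : ℤ → Submodule k carrier
  isInternal : DirectSum.IsInternal deg
  smul_mem : ∀ i j : ℤ, ∀ h ∈ hDeg k p i, ∀ m ∈ deg j, h • m ∈ deg (i + j)

namespace GMod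

variable {k : Type u} [Field k] {p : ℕ}

instance : CoeSort (GMod k p) (Type u) := ⟨carrier⟩

attribute [instance] addCommGroup moduleBase moduleH tower finite

theorem smul_mem_of_xH {V : Type u} [AddCommGroup V] [Module k V] [Module (H k p) V]
    [IsScalarTower k (H k p) V] (A : ℤ → Submodule k V)
    (hA : ∀ j, ∀ v ∈ A j, xH k p • v ∈ A (1 + j)) :
    ∀ i j : ℤ, ∀ h ∈ hDeg k p i, ∀ m ∈ A j, h • m ∈ A (i + j) := by
  intro i j h hh m hm
  induction hh using Submodule.span_induction with
  | mem h hh =>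
    obtain ⟨n, rfl, rfl⟩ := hh
    induction n with
    | zero => simpa using hm
    | succ n ih =>
      rw [pow_succ', mul_smul, Nat.cast_succ, add_comm (n : ℤ), add_assoc]
      exact hA _ _ ih
  | zero => simp
  | add a b _ _ ha hb => rw [add_smul]; exact add_mem ha hb
  | smul c a _ ha => rw [smul_assoc]; exact Submodule.smul_mem _ _ ha

theorem xH_smul_mem (M : GMod k p) {j : ℤ} {m : M} (hm : m ∈ M.deg j) :
    xH k p • m ∈ M.deg (1 + j) :=
  M.smul_mem 1 j _ (by simpa using xH_pow_mem k p 1) m hm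

/-- Morphisms of graded modules: `H`-linear maps preserving degrees. -/
@[ext]
structure Hom (M N : GMod k p) where
  toLin : M →ₗ[H k p] N
  map_deg : ∀ i, ∀ m ∈ M.deg i, toLin m ∈ N.deg i

instance : Category (GMod k p) where
  Hom := Hom
  id M := ⟨LinearMap.id, fun _ _ h => h⟩
  comp f g := ⟨g.toLin ∘ₗ f.toLin, fun i m h => g.map_deg i _ (f.map_deg i m h)⟩

@[ext]
theorem hom_ext {M N : GMod k p} {f g : M ⟶ N} (h : f.toLin = g.toLin) : f = g := Hom.ext h

@[simp] theorem id_toLin (M : GMod k p) : Hom.toLin (𝟙 M) = LinearMap.id := rfl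

@[simp] theorem comp_toLin {M N L : GMod k p} (f : M ⟶ N) (g : N ⟶ L) :
    (f ≫ g).toLin = g.toLin ∘ₗ f.toLin := rfl

section Preadditive

variable (M N : GMod k p)

instance : Zero (M ⟶ N) := ⟨⟨0, fun i _ _ => (N.deg i).zero_mem⟩⟩
instance : Add (M ⟶ N) :=
  ⟨fun f g => ⟨f.toLin + g.toLin, fun i m h => add_mem (f.map_deg i m h) (g.map_deg i m h)⟩⟩
instance : Neg (M ⟶ N) := ⟨fun f => ⟨-f.toLin, fun i m h => neg_mem (f.map_deg i m h)⟩⟩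
instance : Sub (M ⟶ N) :=
  ⟨fun f g => ⟨f.toLin - g.toLin, fun i m h => sub_mem (f.map_deg i m h) (g.map_deg i m h)⟩⟩
instance : SMul ℕ (M ⟶ N) :=
  ⟨fun n f => ⟨n • f.toLin, fun i m h => nsmul_mem (f.map_deg i m h) n⟩⟩
instance : SMul ℤ (M ⟶ N) :=
  ⟨fun n f => ⟨n • f.toLin, fun i m h => zsmul_mem (f.map_deg i m h) n⟩⟩

instance : AddCommGroup (M ⟶ N) :=
  Function.Injective.addCommGroup (fun f : M ⟶ N => f.toLin) (fun _ _ h => hom_ext h) rfl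
    (fun _ _ => rfl) (fun _ => rfl) (fun _ _ => rfl) (fun _ _ => rfl) (fun _ _ => rfl)

instance : Preadditive (GMod k p) where
  add_comp _ _ _ _ _ _ := hom_ext (LinearMap.comp_add _ _ _)
  comp_add _ _ _ _ _ _ := hom_ext (LinearMap.add_comp _ _ _)

end Preadditive

/-- The grading shift `M{n}`, moving every degree up by `n`. -/
def shift (M : GMod k p) (n : ℤ) : GMod k p where
  carrier := M
  deg i := M.deg (i - n)
  isInternal := by
    obtain ⟨d, hd, -⟩ := exists_coaction M.isInternal
    refine isInternal_of_coaction _ ?_ ((Finsupp.lmapDomain _ k (fun i => i + n)) ∘ₗ d) ?_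
    · rw [← M.isInternal.submodule_iSup_eq_top]
      exact (Equiv.subRight n).iSup_congr fun _ => rfl
    · intro i v hv
      simp [hd _ v hv]
  smul_mem i j h hh m hm := by
    have := M.smul_mem i (j - n) h hh m hm
    rwa [← add_sub_assoc] at this

/-- The total grading on `M ⊗ N`. -/
def diagDeg (M N : GMod k p) (n : ℤ) : Submodule k (DiagTensor k M N) :=
  tensorDeg M.deg N.deg n

theorem isInternal_diagDeg (M N : GMod k p) : DirectSum.IsInternal (diagDeg M N) :=
  isInternal_tensorDeg M.isInternal N.isInternal

section Monoidal

variable [Fact p.Prime]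

/-- `H` as a graded module over itself. -/
def regular (k : Type u) [Field k] (p : ℕ) [Fact p.Prime] : GMod k p where
  carrier := H k p
  deg := hDeg k p
  isInternal := isInternal_hDeg k p
  smul_mem := smul_mem_of_xH _ (by
    intro j v hv
    induction hv using Submodule.span_induction with
    | mem h hh =>
      obtain ⟨n, rfl, rfl⟩ := hh
      rw [smul_eq_mul, ← pow_succ']
      exact Submodule.subset_span ⟨n + 1, by push_cast; ring, rfl⟩
    | zero => simp
    | add a b _ _ ha hb => rw [smul_add]; exact add_mem ha hb
    | smul c a _ ha => rw [smul_comm]; exact Submodule.smul_mem _ _ ha)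

theorem ker_modSocle (k : Type u) [Field k] (p : ℕ) [Fact p.Prime] :
    LinearMap.ker ((Submodule.span (H k p) {integralH k p}).mkQ.restrictScalars k) =
      Submodule.span k {integralH k p} := by
  ext x
  rw [LinearMap.mem_ker, LinearMap.restrictScalars_apply, Submodule.mkQ_apply,
    Submodule.Quotient.mk_eq_zero]
  constructor
  · intro hx
    obtain ⟨h, rfl⟩ := Submodule.mem_span_singleton.1 hx
    have hh : h ∈ Submodule.span k (Set.range fun n : ℕ => xH k p ^ n) :=
      span_xH_pow k p ▸ Submodule.mem_top
    induction hh using Submodule.span_induction with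
    | mem h hh =>
      obtain ⟨n, rfl⟩ := hh
      cases n with
      | zero => simp
      | succ n => simp [pow_succ, mul_assoc, xH_mul_integralH]
    | zero => simp
    | add a b _ _ ha hb =>
      rw [add_smul]
      exact add_mem (ha (Submodule.smul_mem _ _ (Submodule.mem_span_singleton_self _)))
        (hb (Submodule.smul_mem _ _ (Submodule.mem_span_singleton_self _)))
    | smul c a _ ha =>
      rw [smul_assoc]
      exact Submodule.smul_mem _ _
        (ha (Submodule.smul_mem _ _ (Submodule.mem_span_singleton_self _)))
  · intro hx
    obtain ⟨c, rfl⟩ := Submodule.mem_span_singleton.1 hx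
    exact Submodule.smul_of_tower_mem _ c (Submodule.mem_span_singleton_self _)

theorem isInternal_modSocle (k : Type u) [Field k] (p : ℕ) [Fact p.Prime] :
    DirectSum.IsInternal (fun i => (hDeg k p i).map
      ((Submodule.span (H k p) {integralH k p}).mkQ.restrictScalars k)) :=
  isInternal_map (isInternal_hDeg k p)
    ((Submodule.span (H k p) {integralH k p}).mkQ.restrictScalars k)
    (Submodule.mkQ_surjective (Submodule.span (H k p) {integralH k p}))
    {integralH k p} (ker_modSocle k p) (by
      rintro _ rfl
      exact ⟨_, xH_pow_mem k p _⟩)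

/-- The quotient `H / kΛ` of `H` by the ideal `kΛ = HΛ`. -/
def regularModSocle (k : Type u) [Field k] (p : ℕ) [Fact p.Prime] : GMod k p where
  carrier := H k p ⧸ Submodule.span (H k p) {integralH k p}
  deg i := (hDeg k p i).map
    ((Submodule.span (H k p) {integralH k p}).mkQ.restrictScalars k)
  isInternal := isInternal_modSocle k p
  smul_mem := by
    rintro i j h hh _ ⟨m, hm, rfl⟩
    exact ⟨h • m, (regular k p).smul_mem i j h hh m hm, rfl⟩

/-- The integral `Λ`, as an element of the graded module `H` shifted so that `Λ` has degree `0`. -/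
def integral (k : Type u) [Field k] (p : ℕ) [Fact p.Prime] : (regular k p).shift (1 - p) :=
  integralH k p

theorem xH_smul_integral : xH k p • integral k p = 0 := xH_mul_integralH k p

variable [CharP k p]

/-- The graded module `k`, in degree `0`, on which `H` acts through the counit. -/
def unit (k : Type u) [Field k] (p : ℕ) [Fact p.Prime] [CharP k p] : GMod k p where
  carrier := k
  moduleH := Module.compHom k (counitH k p).toRingHom
  tower :=
    letI := Module.compHom k (counitH k p).toRingHom
    ⟨fun c h m => by
      change counitH k p (c • h) * m = c * (counitH k p h * m)
      rw [map_smul, smul_eq_mul, mul_assoc]⟩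
  deg i := if i = 0 then ⊤ else ⊥
  isInternal := by
    refine isInternal_of_coaction _ ?_ (Finsupp.lsingle 0) ?_
    · exact top_unique (le_iSup_of_le 0 (by simp))
    · intro n v hv
      split_ifs at hv with h
      · rw [h]; rfl
      · rw [(Submodule.mem_bot k).1 hv]; simp
  smul_mem :=
    letI := Module.compHom k (counitH k p).toRingHom
    haveI : IsScalarTower k (H k p) k := ⟨fun c h m => by
      change counitH k p (c • h) * m = c * (counitH k p h * m)
      rw [map_smul, smul_eq_mul, mul_assoc]⟩
    smul_mem_of_xH _ (by
      intro j v _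
      have h0 : xH k p • v = 0 := by
        change counitH k p (xH k p) * v = 0
        rw [counitH, xH, AdjoinRoot.liftAlgHom_root, zero_mul]
      rw [h0]
      exact Submodule.zero_mem _)

theorem smul_mem_diagDeg (M N : GMod k p) :
    ∀ i j : ℤ, ∀ h ∈ hDeg k p i, ∀ m ∈ diagDeg M N j, h • m ∈ diagDeg M N (i + j) :=
  smul_mem_of_xH (diagDeg M N)
    (tensorAction_mem (fun _ _ => M.xH_smul_mem) (fun _ _ => N.xH_smul_mem))

/-- The tensor product over `k` of graded `H`-modules; `H` acts through the comultiplication. -/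
def tensor (M N : GMod k p) : GMod k p where
  carrier := DiagTensor k M N
  deg := diagDeg M N
  isInternal := isInternal_diagDeg M N
  smul_mem := smul_mem_diagDeg M N

/-- Pure tensors, as elements of the graded module `M ⊗ N`. -/
def tmul {M N : GMod k p} (m : M) (n : N) : tensor M N := m ⊗ₜ[k] n

theorem zero_tmul {M N : GMod k p} (n : N) : tmul (0 : M) n = 0 :=
  TensorProduct.zero_tmul (R := k) M n

theorem tmul_zero {M N : GMod k p} (m : M) : tmul m (0 : N) = 0 :=
  TensorProduct.tmul_zero (R := k) N m

theorem tmul_add {M N : GMod k p} (m : M) (a b : N) : tmul m (a + b) = tmul m a + tmul m b :=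
  TensorProduct.tmul_add (R := k) m a b

theorem xH_smul_tmul {M N : GMod k p} (m : M) (n : N) :
    xH k p • tmul m n = tmul (xH k p • m) n + tmul m (xH k p • n) :=
  tensorAction_xH M N m n

theorem tensor_induction {M N : GMod k p} {C : tensor M N → Prop} (t : tensor M N)
    (h0 : C 0) (ht : ∀ m n, C (tmul m n)) (ha : ∀ a b, C a → C b → C (a + b)) : C t :=
  TensorProduct.induction_on t h0 ht ha

/-- The tensor product of two `H`-linear maps is `H`-linear. -/
def tensorMapLin {M M' N N' : GMod k p} (f : M →ₗ[H k p] M') (g : N →ₗ[H k p] N') :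
    tensor M N →ₗ[H k p] tensor M' N' :=
  let F : tensor M N →ₗ[k] tensor M' N' :=
    TensorProduct.map (f.restrictScalars k) (g.restrictScalars k)
  linearOfX F (fun t => by
    induction t using tensor_induction with
    | h0 => rw [smul_zero, map_zero, smul_zero]
    | ht m n =>
      have hF : ∀ m n, F (tmul m n) = tmul (f m) (g n) := fun _ _ => rfl
      rw [xH_smul_tmul, map_add, hF, hF, hF, xH_smul_tmul, map_smul, map_smul]
    | ha a b ha hb => rw [smul_add, map_add, ha, hb, map_add, smul_add])

theorem tensorMapLin_tmul {M M' N N' : GMod k p} (f : M →ₗ[H k p] M') (g : N →ₗ[H k p] N')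
    (m : M) (n : N) : tensorMapLin f g (tmul m n) = tmul (f m) (g n) := rfl

theorem tensor_hom_ext {M N : GMod k p} {L : Type u} [AddCommGroup L] [Module (H k p) L]
    {f g : tensor M N →ₗ[H k p] L} (h : ∀ m n, f (tmul m n) = g (tmul m n)) : f = g := by
  ext t
  induction t using tensor_induction with
  | h0 => rw [map_zero, map_zero]
  | ht m n => exact h m n
  | ha a b ha hb => rw [map_add, map_add, ha, hb]

/-- The tensor product of two morphisms. -/
def tensorMap {M M' N N' : GMod k p} (f : M ⟶ M') (g : N ⟶ N') : tensor M N ⟶ tensor M' N' where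
  toLin := tensorMapLin f.toLin g.toLin
  map_deg n t ht := by
    induction ht using Submodule.span_induction with
    | mem t ht =>
      obtain ⟨i, j, rfl, v, hv, w, hw, rfl⟩ := ht
      exact tmul_mem_tensorDeg rfl (f.map_deg _ _ hv) (g.map_deg _ _ hw)
    | zero => exact (map_zero (tensorMapLin f.toLin g.toLin)).symm ▸ Submodule.zero_mem _
    | add a b _ _ ha hb =>
      exact (map_add (tensorMapLin f.toLin g.toLin) a b).symm ▸ add_mem ha hb
    | smul c a _ ha =>
      exact ((tensorMapLin f.toLin g.toLin).map_smul_of_tower c a).symm ▸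
        Submodule.smul_mem _ _ ha

/-- The functor `M ↦ V ⊗ M`. -/
def tensorLeft (V : GMod k p) : GMod k p ⥤ GMod k p where
  obj M := tensor V M
  map f := tensorMap (𝟙 V) f
  map_id _ := hom_ext (tensor_hom_ext fun _ _ => rfl)
  map_comp _ _ := hom_ext (tensor_hom_ext fun _ _ => rfl)

/-- `H ⊗ M` is projective: it is isomorphic to the free module on the vector space `M`. -/
theorem projective_regular_tensor (M : GMod k p) :
    Module.Projective (H k p) (tensor (regular k p) M) := by
  let one : regular k p := (1 : H k p)
  let j : M →ₗ[k] tensor (regular k p) M := TensorProduct.mk k (H k p) M 1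
  have hj : ∀ m, j m = tmul one m := fun _ => rfl
  let F : (H k p ⊗[k] M) →ₗ[H k p] tensor (regular k p) M := j.liftBaseChange (H k p)
  have hF : ∀ h m, F (h ⊗ₜ m) = h • tmul one m := fun h m => by
    rw [LinearMap.liftBaseChange_tmul, hj]
  have hpow : ∀ (n : ℕ) (m : M), tmul (xH k p ^ n • one) m ∈ LinearMap.range F := by
    intro n
    induction n with
    | zero =>
      intro m
      exact ⟨1 ⊗ₜ m, by rw [hF, pow_zero, one_smul, one_smul]⟩
    | succ n ih =>
      intro m
      have h := xH_smul_tmul (xH k p ^ n • one) m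
      rw [← mul_smul, ← pow_succ', ← sub_eq_iff_eq_add] at h
      rw [← h]
      exact sub_mem (Submodule.smul_mem _ _ (ih m)) (ih _)
  have hsurj : Function.Surjective F := by
    rw [← LinearMap.range_eq_top, eq_top_iff]
    rintro t -
    induction t using tensor_induction with
    | h0 => exact Submodule.zero_mem _
    | ha a b ha hb => exact add_mem ha hb
    | ht h m =>
      have hh : h ∈ Submodule.span k (Set.range fun n : ℕ => xH k p ^ n) :=
        span_xH_pow k p ▸ Submodule.mem_top (x := (h : H k p))
      have hlin : ∀ (c : k) (a : regular k p), tmul (c • a) m = c • tmul a m :=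
        fun c a => TensorProduct.smul_tmul' c (a : H k p) m
      have hadd : ∀ a b : regular k p, tmul (a + b) m = tmul a m + tmul b m :=
        fun a b => TensorProduct.add_tmul (R := k) (M := H k p) a b m
      induction hh using Submodule.span_induction with
      | mem h hh =>
        obtain ⟨n, rfl⟩ := hh
        have := hpow n m
        have h1 : xH k p ^ n • one = (xH k p ^ n : H k p) :=
          mul_one (xH k p ^ n)
        rwa [h1] at this
      | zero => exact (zero_tmul (M := regular k p) m).symm ▸ Submodule.zero_mem _
      | add a b _ _ ha hb =>
        exact (hadd a b).symm ▸ add_mem ha hb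
      | smul c a _ ha => exact (hlin c a).symm ▸ Submodule.smul_of_tower_mem _ c ha
  have hinj : Function.Injective F := by
    have hfin : Module.finrank k (H k p ⊗[k] M) =
      Module.finrank k (tensor (regular k p) M) := rfl
    have : Function.Injective (F.restrictScalars k) :=
      (LinearMap.injective_iff_surjective_of_finrank_eq_finrank hfin).2 hsurj
    exact this
  exact Module.Projective.of_equiv (LinearEquiv.ofBijective F ⟨hinj, hsurj⟩)

/-- The `H`-linear isomorphism `V ⊗ (M ⊗ N) ≅ M ⊗ (V ⊗ N)` permuting the factors. -/
def leftCommLin (V M N : GMod k p) :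
    tensor V (tensor M N) →ₗ[H k p] tensor M (tensor V N) :=
  let F : tensor V (tensor M N) →ₗ[k] tensor M (tensor V N) :=
    (TensorProduct.leftComm k V M N).toLinearMap
  linearOfX F (fun t => by
    have hF : ∀ v m n, F (tmul v (tmul m n)) = tmul m (tmul v n) := fun _ _ _ => rfl
    induction t using tensor_induction with
    | h0 => rw [smul_zero, map_zero, smul_zero]
    | ha a b ha hb => rw [smul_add, map_add, ha, hb, map_add, smul_add]
    | ht v s =>
      induction s using tensor_induction with
      | h0 => rw [tmul_zero, smul_zero, map_zero, smul_zero]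
      | ha a b ha hb => rw [tmul_add, smul_add, map_add, ha, hb, map_add, smul_add]
      | ht m n =>
        rw [xH_smul_tmul, xH_smul_tmul, tmul_add, hF, map_add, map_add, hF, hF, hF, xH_smul_tmul,
          xH_smul_tmul, tmul_add]
        abel)

/-- The `H`-linear map `ε ⊗ id : H ⊗ M → M`. -/
def counitLin (M : GMod k p) : tensor (regular k p) M →ₗ[H k p] M :=
  let F : tensor (regular k p) M →ₗ[k] M :=
    (TensorProduct.lid k M).toLinearMap ∘ₗ LinearMap.rTensor M (counitH k p).toLinearMap
  linearOfX F (fun t => by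
    let e : regular k p → k := fun h => counitH k p h
    have hF : ∀ (h : regular k p) m, F (tmul h m) = e h • m := fun _ _ => rfl
    have he : ∀ h : regular k p, e (xH k p • h) = 0 := fun h => by
      change counitH k p (xH k p * (show H k p from h)) = 0
      rw [map_mul, counitH, xH, AdjoinRoot.liftAlgHom_root, zero_mul]
    induction t using tensor_induction with
    | h0 => rw [smul_zero, map_zero, smul_zero]
    | ha a b ha hb => rw [smul_add, map_add, ha, hb, map_add, smul_add]
    | ht h m =>
      rw [xH_smul_tmul, map_add, hF, hF, hF, he, zero_smul, zero_add, smul_comm])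

/-- The tensor product of any module with a projective module is projective. -/
theorem projective_tensor (V P : GMod k p) (hP : Module.Projective (H k p) P) :
    Module.Projective (H k p) (tensor V P) := by
  have hs : Function.Surjective (counitLin P) := fun m =>
    ⟨tmul (M := regular k p) (1 : H k p) m, by
      change counitH k p 1 • m = m
      rw [map_one, one_smul]⟩
  obtain ⟨s, hs⟩ := Module.projective_lifting_property (counitLin P) LinearMap.id hs
  have := projective_regular_tensor (tensor V P)
  refine Module.Projective.of_split (leftCommLin V (regular k p) P ∘ₗ tensorMapLin LinearMap.id s)
    (tensorMapLin LinearMap.id (counitLin P) ∘ₗ leftCommLin (regular k p) V P)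
    (tensor_hom_ext fun v m => ?_)
  have hinv : ∀ t, leftCommLin (regular k p) V P (leftCommLin V (regular k p) P t) = t := by
    intro t
    exact (TensorProduct.leftComm k V (H k p) P).symm_apply_apply t
  rw [LinearMap.comp_apply, LinearMap.comp_apply, LinearMap.comp_apply, hinv, tensorMapLin_tmul,
    tensorMapLin_tmul, ← LinearMap.comp_apply (counitLin P), hs]
  rfl

/-- The embedding `M → H ⊗ M`, `m ↦ Λ ⊗ m`, where `H` is shifted so that `Λ` has degree `0`. -/
def integralEmb (M : GMod k p) : M ⟶ tensor ((regular k p).shift (1 - p)) M where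
  toLin := linearOfX
    (show M →ₗ[k] tensor ((regular k p).shift (1 - p)) M from
      TensorProduct.mk k (H k p) M (integralH k p)) (fun m => by
    have h : xH k p • tmul (integral k p) m = tmul (integral k p) (xH k p • m) := by
      rw [xH_smul_tmul, xH_smul_integral, zero_tmul, zero_add]
    exact h.symm)
  map_deg i m hm := by
    refine tmul_mem_tensorDeg (i := 0) (j := i) (zero_add i) ?_ hm
    change integralH k p ∈ hDeg k p (0 - (1 - p))
    have h := xH_pow_mem k p (p - 1)
    rw [Nat.cast_sub (Fact.out : p.Prime).one_le] at h
    rw [Nat.cast_one] at h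
    rwa [zero_sub, neg_sub]

/-- The projection `H → H / kΛ`, both shifted down by `p - 1`. -/
def projModSocle (k : Type u) [Field k] (p : ℕ) [Fact p.Prime] :
    (regular k p).shift (1 - p) ⟶ (regularModSocle k p).shift (1 - p) where
  toLin := (Submodule.span (H k p) {integralH k p}).mkQ
  map_deg _ m hm := ⟨m, hm, rfl⟩

/-- The functor `T M = (H / kΛ) ⊗ M` on graded modules, with `H` shifted so that `Λ` has
degree `0`. -/
def suspension (k : Type u) [Field k] (p : ℕ) [Fact p.Prime] [CharP k p] :
    GMod k p ⥤ GMod k p :=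
  tensorLeft ((regularModSocle k p).shift (1 - p))

/-- The quotient map `H ⊗ M → T M`. -/
def suspensionProj (M : GMod k p) :
    tensor ((regular k p).shift (1 - p)) M ⟶ (suspension k p).obj M :=
  tensorMap (projModSocle k p) (𝟙 M)

end Monoidal

end GMod

/-! ### The stable category -/

section Stable

variable (k : Type u) [Field k] (p : ℕ)

/-- Two morphisms are identified in the stable category when their difference factors through a
projective module. -/
def stableRel : HomRel (GMod k p) := fun M N f g =>
  ∃ P : GMod k p, Module.Projective (H k p) P ∧ ∃ (a : M ⟶ P) (b : P ⟶ N), f - g = a ≫ b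

/-- The stable category of finite-dimensional graded `H`-modules. -/
abbrev StableCat : Type (u + 1) := CategoryTheory.Quotient (stableRel k p)

/-- The quotient functor to the stable category. -/
abbrev toStable : GMod k p ⥤ StableCat k p := CategoryTheory.Quotient.functor (stableRel k p)

variable [Fact p.Prime] [CharP k p]

/-- The translation functor `T` of the stable category. -/
def stableT : StableCat k p ⥤ StableCat k p :=
  CategoryTheory.Quotient.lift (stableRel k p) (GMod.suspension k p ⋙ toStable k p) (by
    rintro M N f g ⟨P, hP, a, b, hab⟩
    refine CategoryTheory.Quotient.sound _
      ⟨(GMod.suspension k p).obj P, GMod.projective_tensor _ _ hP,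
        (GMod.suspension k p).map a, (GMod.suspension k p).map b, ?_⟩
    rw [← Functor.map_comp, ← hab]
    refine GMod.hom_ext (GMod.tensor_hom_ext fun m n => ?_)
    exact (TensorProduct.tmul_sub _ _ _).symm)

end Stable

/-! ### Triangles and the Grothendieck group -/

section Triangles

universe v w

variable {C : Type w} [Category.{v} C]

/-- Sextuples `X → Y → Z → T X` in a category with an endofunctor `T`. -/
structure Sextuple (T : C ⥤ C) where
  X : C
  Y : C
  Z : C
  u : X ⟶ Y
  v : Y ⟶ Z
  w : Z ⟶ T.obj X

/-- Isomorphism of sextuples. -/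
def Sextuple.Isom {T : C ⥤ C} (s t : Sextuple T) : Prop :=
  ∃ (a : s.X ≅ t.X) (b : s.Y ≅ t.Y) (c : s.Z ≅ t.Z),
    s.u ≫ b.hom = a.hom ≫ t.u ∧ s.v ≫ c.hom = b.hom ≫ t.v ∧ s.w ≫ T.map a.hom = c.hom ≫ t.w

/-- The Grothendieck group of a category with a translation functor and a class of distinguished
triangles: generators `[X]` for the objects `X`, and relations `[Y] = [X] + [Z]` for the
distinguished triangles `X → Y → Z → T X`. -/
abbrev GrothendieckGroup (T : C ⥤ C) (dist : Sextuple T → Prop) : Type w :=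
  FreeAbelianGroup C ⧸ AddSubgroup.closure
    {x | ∃ t : Sextuple T, dist t ∧
      x = FreeAbelianGroup.of t.Y - (FreeAbelianGroup.of t.X + FreeAbelianGroup.of t.Z)}

end Triangles

section Main

variable {k : Type u} [Field k] {p : ℕ} [Fact p.Prime] [CharP k p]

/-- Standard distinguished triangles `X → Y → C → T X`: here `C` is the cone of `f : X → Y`, the
pushout of `f` and `X → H ⊗ X`, and `h : C → T X` is the map induced by `H ⊗ X → T X`
and by `0 : Y → T X`. -/
def IsStandard (t : Sextuple (stableT k p)) : Prop :=
  ∃ (X Y C : GMod k p) (f : X ⟶ Y) (g : Y ⟶ C)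
    (f' : GMod.tensor ((GMod.regular k p).shift (1 - p)) X ⟶ C)
    (h : C ⟶ (GMod.suspension k p).obj X),
    IsPushout f (GMod.integralEmb X) g f' ∧ g ≫ h = 0 ∧ f' ≫ h = GMod.suspensionProj X ∧
    t = { X := (toStable k p).obj X
          Y := (toStable k p).obj Y
          Z := (toStable k p).obj C
          u := (toStable k p).map f
          v := (toStable k p).map g
          w := (toStable k p).map h }

/-- Distinguished triangles: the sextuples isomorphic to a standard one. -/
def IsDistinguished (t : Sextuple (stableT k p)) : Prop :=
  ∃ s : Sextuple (stableT k p), IsStandard s ∧ t.Isom s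

variable (k p) in
/-- The Grothendieck group of the stable category of finite-dimensional graded `H`-modules. -/
abbrev K0Stable : Type (u + 1) :=
  GrothendieckGroup (stableT k p) IsDistinguished

/-- The class `[M]` of a graded module in the Grothendieck group of the stable category. -/
def cls (M : GMod k p) : K0Stable k p :=
  QuotientAddGroup.mk (FreeAbelianGroup.of ((toStable k p).obj M))

end Main

/-- The ring `R_p = ℤ[q]/(1 + q + ⋯ + q ^ (p - 1))`. -/
abbrev CycloRing (p : ℕ) : Type :=
  AdjoinRoot (∑ i ∈ Finset.range p, Polynomial.X ^ i : Polynomial ℤ)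

/-- The class of `q` in `R_p`. -/
def CycloRing.q (p : ℕ) : CycloRing p := AdjoinRoot.root _

end KStable

end

noncomputable section

namespace KStable

/-! ### Homogeneous components -/

section Components

variable {k : Type u} [Field k] {V W : Type u} [AddCommGroup V] [Module k V]
  [AddCommGroup W] [Module k W]

/-! The isomorphism is the graded dimension $\sum_n \dim M_n\,q^n$, read in $R_p$. Its inverse sends
$q^n$ to the class of the trivial module $k\{n\}$.

The graded dimension is well defined on the Grothendieck group. It is additive on short exact
sequences (`ShortExact.wdim_eq`). It vanishes on projectives: if $X^j m=0$ with $j<p$ in a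
projective $M$, then $m\in XM$, so the dimensions of the $M_i$ are sums over $p$ consecutive degrees
of the dimensions of $M/XM$ (`finrank_deg_of_projective`, `wdim_projective`). Stably isomorphic
modules become isomorphic after projective summands are added, up to a split sequence
(`wdim_of_null`), and a cone is the cokernel of an embedding $X\to Y\oplus(H\otimes X)$
(`wdim_cone`). All this is done for any weights $w(n)$ in an abelian group that sum to zero over $p$
consecutive degrees. In $R_p$ the powers of $q$ are such weights, because $q$ is invertible there.

In the other direction, every short exact sequence $0\to X\to Y\to Z\to 0$ gives $[Y]=[X]+[Z]$
(`cls_of_shortExact`). The reason is that $H\otimes X$ is injective among graded modules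
(`HasDerivation.exists_extension`): the embedding $X\to H\otimes X$ extends to $Y$, so the cone of
$X\to Y$ is $Z\oplus(H\otimes X)$, which is stably $Z$. Injectivity comes from the operator $d/dX$
on $H$, which satisfies $dX-Xd=1$. It allows a $k$-linear extension to be corrected, step by step,
into an $H$-linear one.

A nonzero element of top degree is killed by $X$, so every module is filtered by shifts of $k$, and
$[M]=\sum_n\dim M_n\,[k\{n\}]$ (`cls_eq_wdim`). For $M=H\{i\}$, which is projective, this says that
$p$ consecutive classes $[k\{n\}]$ sum to zero. These classes are therefore $p$-periodic, and
$q^n\mapsto[k\{n\}]$ is a surjection `polyToK` from $\mathbb Z[q]$ that kills the ideal of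
$1+\dots+q^{p-1}$. Followed by the graded dimension it is the quotient map to $R_p$, which gives
bijectivity. Surjectivity of `polyToK` also gives uniqueness. -/

theorem exists_proj {A : ℤ → Submodule k V} (h : DirectSum.IsInternal A) :
    ∃ π : ℤ → V →ₗ[k] V, (∀ n v, π n v ∈ A n) ∧ (∀ n, ∀ v ∈ A n, π n v = v) ∧
      ∀ m n, m ≠ n → ∀ v ∈ A m, π n v = 0 := by
  obtain ⟨d, hd, hd'⟩ := exists_coaction h
  refine ⟨fun n => (Finsupp.lapply n : (ℤ →₀ V) →ₗ[k] V) ∘ₗ d, fun n v => hd' v n, ?_, ?_⟩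
  · intro n v hv
    simp [hd n v hv]
  · intro m n hmn v hv
    simp [hd m v hv, hmn]

theorem internal_induction {A : ℤ → Submodule k V} (h : DirectSum.IsInternal A) {P : V → Prop}
    (v : V) (hh : ∀ n, ∀ v ∈ A n, P v) (ha : ∀ a b, P a → P b → P (a + b)) : P v := by
  have hv : v ∈ iSup A := h.submodule_iSup_eq_top ▸ Submodule.mem_top
  induction hv using Submodule.iSup_induction' with
  | mem i v hv => exact hh i v hv
  | zero => exact hh 0 0 (Submodule.zero_mem _)
  | add a b _ _ hx hy => exact ha a b hx hy

/-- A linear map out of a graded space is defined by its restrictions to the components. -/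
theorem exists_extend_components {A : ℤ → Submodule k V} (h : DirectSum.IsInternal A)
    (f : ∀ n, A n →ₗ[k] W) : ∃ F : V →ₗ[k] W, ∀ n (v : A n), F v = f n v := by
  let e := LinearEquiv.ofBijective (DirectSum.coeLinearMap A) h
  refine ⟨DirectSum.toModule k ℤ W f ∘ₗ e.symm.toLinearMap, fun n v => ?_⟩
  have he : e (DirectSum.lof k ℤ (fun i => A i) n v) = v := DirectSum.coeLinearMap_lof A n v
  rw [← he]
  simp

theorem finite_deg_ne_bot [Module.Finite k V] {A : ℤ → Submodule k V}
    (h : DirectSum.IsInternal A) : {n | A n ≠ ⊥}.Finite :=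
  WellFoundedGT.finite_ne_bot_of_iSupIndep h.submodule_iSupIndep

/-- Homogeneous components, as linear projections compatible with maps of graded spaces. -/
theorem exists_proj_comm {A : ℤ → Submodule k V} {B : ℤ → Submodule k W}
    (hA : DirectSum.IsInternal A) (hB : DirectSum.IsInternal B) (f : V →ₗ[k] W)
    (hf : ∀ n, ∀ v ∈ A n, f v ∈ B n) (n : ℤ) :
    ∃ (π : V →ₗ[k] V) (ρ : W →ₗ[k] W), (∀ v, π v ∈ A n) ∧ (∀ w ∈ B n, ρ w = w) ∧
      ∀ v, ρ (f v) = f (π v) := by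
  obtain ⟨π, h1, h2, h3⟩ := exists_proj hA
  obtain ⟨ρ, r1, r2, r3⟩ := exists_proj hB
  refine ⟨π n, ρ n, h1 n, r2 n, fun v => ?_⟩
  refine internal_induction hA (P := fun v => ρ n (f v) = f (π n v)) v (fun m v hv => ?_)
    (fun a b ha hb => ?_)
  · by_cases hmn : m = n
    · subst hmn
      rw [h2 _ _ hv, r2 _ _ (hf _ _ hv)]
    · rw [h3 _ _ hmn _ hv, r3 _ _ hmn _ (hf _ _ hv), map_zero]
  · simp [ha, hb]

theorem mem_deg_of_map_mem {A : ℤ → Submodule k V} {B : ℤ → Submodule k W}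
    (hA : DirectSum.IsInternal A) (hB : DirectSum.IsInternal B) (f : V →ₗ[k] W)
    (hf : ∀ n, ∀ v ∈ A n, f v ∈ B n) (hinj : Function.Injective f) {n : ℤ} {v : V}
    (hv : f v ∈ B n) : v ∈ A n := by
  obtain ⟨π, ρ, h1, r2, hc⟩ := exists_proj_comm hA hB f hf n
  have := hc v
  rw [r2 _ hv] at this
  rw [hinj this]
  exact h1 _

theorem exists_homogeneous_preimage {A : ℤ → Submodule k V} {B : ℤ → Submodule k W}
    (hA : DirectSum.IsInternal A) (hB : DirectSum.IsInternal B) (f : V →ₗ[k] W)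
    (hf : ∀ n, ∀ v ∈ A n, f v ∈ B n) {n : ℤ} {w : W} (hw : w ∈ B n) (hr : ∃ v, f v = w) :
    ∃ v ∈ A n, f v = w := by
  obtain ⟨π, ρ, h1, r2, hc⟩ := exists_proj_comm hA hB f hf n
  obtain ⟨v, rfl⟩ := hr
  refine ⟨π v, h1 _, ?_⟩
  rw [← hc, r2 _ hw]

/-- A map of graded spaces extends along an injective one, in degree zero. -/
theorem exists_graded_extension {U : Type u} [AddCommGroup U] [Module k U]
    {A : ℤ → Submodule k V} {B : ℤ → Submodule k W} {D : ℤ → Submodule k U}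
    (hA : DirectSum.IsInternal A) (hB : DirectSum.IsInternal B) (f : V →ₗ[k] W)
    (hf : ∀ n, ∀ v ∈ A n, f v ∈ B n) (hinj : Function.Injective f) (g : V →ₗ[k] U)
    (hg : ∀ n, ∀ v ∈ A n, g v ∈ D n) :
    ∃ s : W →ₗ[k] U, (∀ n, ∀ w ∈ B n, s w ∈ D n) ∧ s ∘ₗ f = g := by
  -- The extension is built one degree at a time, from a left inverse of the injection $A_n\to B_n$.
  have hex : ∀ n, ∃ s : B n →ₗ[k] D n, ∀ v (hv : v ∈ A n), (s ⟨f v, hf n v hv⟩ : U) = g v := by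
    intro n
    let fn : A n →ₗ[k] B n := f.restrict (hf n)
    let gn : A n →ₗ[k] D n := g.restrict (hg n)
    have hfn : LinearMap.ker fn = ⊥ := LinearMap.ker_eq_bot.2 fun a b hab =>
      Subtype.ext (hinj (congrArg Subtype.val hab))
    obtain ⟨r, hr⟩ := fn.exists_leftInverse_of_injective hfn
    refine ⟨gn ∘ₗ r, fun v hv => ?_⟩
    have : r (fn ⟨v, hv⟩) = ⟨v, hv⟩ := LinearMap.congr_fun hr _
    change ((gn (r (fn ⟨v, hv⟩)) : D n) : U) = _
    rw [this]
    rfl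
  choose s hs using hex
  obtain ⟨F, hF⟩ := exists_extend_components hB (fun n => (D n).subtype ∘ₗ s n)
  refine ⟨F, fun n w hw => ?_, ?_⟩
  · rw [hF n ⟨w, hw⟩]
    exact (s n ⟨w, hw⟩).2
  · ext v
    refine internal_induction hA (P := fun v => (F ∘ₗ f) v = g v) v (fun n v hv => ?_)
      (fun a b ha hb => ?_)
    · have := hF n ⟨f v, hf n v hv⟩
      rw [LinearMap.comp_apply, this]
      exact hs n v hv
    · rw [map_add, map_add, ha, hb]

/-- The projection to degree $n$ fixes the basis vectors of degree $n$ and kills the others, so it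
carries an expansion in the basis to one that uses only degree $n$. -/
theorem span_homogeneous_basis {ι : Type*} {A : ℤ → Submodule k V} (hA : DirectSum.IsInternal A)
    (b : Module.Basis ι k V) (δ : ι → ℤ) (hb : ∀ i, b i ∈ A (δ i)) (n : ℤ) :
    Submodule.span k (Set.range fun i : {i // δ i = n} => b i) = A n := by
  apply le_antisymm
  · rw [Submodule.span_le]
    rintro _ ⟨⟨i, rfl⟩, rfl⟩
    exact hb i
  · obtain ⟨π, h1, h2, h3⟩ := exists_proj hA
    intro v hv
    rw [← h2 n v hv]
    have hv' : v ∈ Submodule.span k (Set.range b) := b.span_eq ▸ Submodule.mem_top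
    clear hv
    induction hv' using Submodule.span_induction with
    | mem v hv =>
      obtain ⟨i, rfl⟩ := hv
      by_cases hi : δ i = n
      · rw [h2 n _ (hi ▸ hb i)]
        exact Submodule.subset_span ⟨⟨i, hi⟩, rfl⟩
      · rw [h3 _ _ hi _ (hb i)]
        exact Submodule.zero_mem _
    | zero => rw [map_zero]; exact Submodule.zero_mem _
    | add a b _ _ ha hb => rw [map_add]; exact add_mem ha hb
    | smul c a _ ha => rw [map_smul]; exact Submodule.smul_mem _ _ ha

/-! ### Dimensions weighted by degree -/

theorem finrank_deg_of_basis {ι : Type*} [Fintype ι] {A : ℤ → Submodule k V}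
    (hA : DirectSum.IsInternal A) (b : Module.Basis ι k V) (δ : ι → ℤ) (hb : ∀ i, b i ∈ A (δ i))
    (n : ℤ) : Module.finrank k (A n) = (Finset.univ.filter fun i => δ i = n).card := by
  classical
  rw [← span_homogeneous_basis hA b δ hb n, finrank_span_eq_card, Fintype.card_subtype]
  exact b.linearIndependent.comp _ Subtype.val_injective

/-- The dimension of a graded space, with degree `n` weighted by `w n`. -/
def weightedDim {G : Type*} [AddCommGroup G] (w : ℤ → G) (A : ℤ → Submodule k V) : G :=
  ∑ᶠ n, Module.finrank k (A n) • w n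

theorem weightedDim_support [Module.Finite k V] {G : Type*} [AddCommGroup G] (w : ℤ → G)
    {A : ℤ → Submodule k V} (hA : DirectSum.IsInternal A) :
    (Function.support fun n => Module.finrank k (A n) • w n).Finite :=
  (finite_deg_ne_bot hA).subset fun n hn h => hn (by
    change Module.finrank k (A n) • w n = 0
    rw [show A n = ⊥ from h, finrank_bot, zero_smul])

/-- Each basis vector contributes its weight once, in its own degree; the two sums are then
exchanged. Shifts, tensor products, $H$ and $k$ are all computed this way. -/
theorem weightedDim_of_basis {ι : Type*} [Fintype ι] {G : Type*} [AddCommGroup G] (w : ℤ → G)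
    {A : ℤ → Submodule k V} (hA : DirectSum.IsInternal A) (b : Module.Basis ι k V) (δ : ι → ℤ)
    (hb : ∀ i, b i ∈ A (δ i)) : weightedDim w A = ∑ i, w (δ i) := by
  classical
  have h1 : ∀ n, Module.finrank k (A n) • w n = ∑ i, if δ i = n then w (δ i) else 0 := by
    intro n
    rw [finrank_deg_of_basis hA b δ hb, ← Finset.sum_filter, ← Finset.sum_const]
    exact Finset.sum_congr rfl fun i hi => by rw [(Finset.mem_filter.1 hi).2]
  rw [weightedDim, finsum_congr h1, finsum_sum_comm]
  · refine Finset.sum_congr rfl fun i _ => ?_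
    rw [finsum_eq_single _ (δ i)]
    · simp
    · intro n hn
      simp [hn.symm]
  · intro i _
    refine (Set.finite_singleton (δ i)).subset fun n hn => ?_
    by_contra h
    exact hn (if_neg fun h' => h h'.symm)

theorem exists_homogeneous_basis [Module.Finite k V] {A : ℤ → Submodule k V}
    (hA : DirectSum.IsInternal A) : ∃ (ι : Type u) (_ : Fintype ι) (b : Module.Basis ι k V)
      (δ : ι → ℤ), ∀ i, b i ∈ A (δ i) := by
  classical
  let v : ∀ n, Module.Basis (Module.Basis.ofVectorSpaceIndex k (A n)) k (A n) :=
    fun n => Module.Basis.ofVectorSpace k (A n)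
  let b := hA.collectedBasis v
  have : Finite (Σ n, Module.Basis.ofVectorSpaceIndex k (A n)) := Module.Finite.finite_basis b
  exact ⟨_, Fintype.ofFinite _, b, fun i => i.1, fun i => hA.collectedBasis_mem v i⟩

end Components

namespace GMod

/-! ### Sums, cokernels and short exact sequences of graded modules -/

section Constructions

variable {k : Type u} [Field k] {p : ℕ}

/-- A map `f` of graded modules as a `k`-linear map. -/
def Hom.toLinBase {M N : GMod k p} (f : M ⟶ N) : M →ₗ[k] N := f.toLin.restrictScalars k

theorem Hom.toLinBase_apply {M N : GMod k p} (f : M ⟶ N) (m : M) : f.toLinBase m = f.toLin m := rfl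

/-- The zero graded module. -/
def zeroObj (k : Type u) [Field k] (p : ℕ) : GMod k p where
  carrier := PUnit.{u + 1}
  deg _ := ⊤
  isInternal := isInternal_of_coaction _ (Subsingleton.elim _ _) 0 fun n v _ => by
    rw [Subsingleton.elim v 0, map_zero, Finsupp.single_zero]
  smul_mem _ _ _ _ _ _ := Submodule.mem_top

instance : Subsingleton (zeroObj k p) := inferInstanceAs (Subsingleton PUnit)

/-- The direct sum of two graded modules. -/
def prod (M N : GMod k p) : GMod k p where
  carrier := M × N
  deg n := (M.deg n).prod (N.deg n)
  isInternal := by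
    obtain ⟨d, hd, -⟩ := exists_coaction M.isInternal
    obtain ⟨e, he, -⟩ := exists_coaction N.isInternal
    refine isInternal_of_coaction _ ?_
      ((Finsupp.mapRange.linearMap (LinearMap.inl k M N)) ∘ₗ d ∘ₗ LinearMap.fst k M N +
        (Finsupp.mapRange.linearMap (LinearMap.inr k M N)) ∘ₗ e ∘ₗ LinearMap.snd k M N) ?_
    · rw [eq_top_iff]
      rintro ⟨m, n⟩ -
      have h1 : ((m, 0) : M × N) ∈ ⨆ i, (M.deg i).prod (N.deg i) :=
        internal_induction M.isInternal
          (P := fun m => ((m, 0) : M × N) ∈ ⨆ i, (M.deg i).prod (N.deg i)) m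
          (fun i v hv => Submodule.mem_iSup_of_mem i ⟨hv, Submodule.zero_mem _⟩)
          (fun a b ha hb => by simpa using add_mem ha hb)
      have h2 : ((0, n) : M × N) ∈ ⨆ i, (M.deg i).prod (N.deg i) :=
        internal_induction N.isInternal
          (P := fun n => ((0, n) : M × N) ∈ ⨆ i, (M.deg i).prod (N.deg i)) n
          (fun i v hv => Submodule.mem_iSup_of_mem i ⟨Submodule.zero_mem _, hv⟩)
          (fun a b ha hb => by simpa using add_mem ha hb)
      simpa using add_mem h1 h2
    · rintro n ⟨a, b⟩ ⟨ha, hb⟩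
      simp [hd n a ha, he n b hb, ← Finsupp.single_add]
  smul_mem i j h hh m hm := ⟨M.smul_mem i j h hh _ hm.1, N.smul_mem i j h hh _ hm.2⟩

variable (M N : GMod k p)

/-- The first inclusion into a direct sum. -/
def inl : M ⟶ prod M N := ⟨LinearMap.inl (H k p) M N, fun _ _ hm => ⟨hm, Submodule.zero_mem _⟩⟩

/-- The second inclusion into a direct sum. -/
def inr : N ⟶ prod M N := ⟨LinearMap.inr (H k p) M N, fun _ _ hm => ⟨Submodule.zero_mem _, hm⟩⟩

/-- The first projection from a direct sum. -/
def fst : prod M N ⟶ M := ⟨LinearMap.fst (H k p) M N, fun _ _ hm => hm.1⟩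

/-- The second projection from a direct sum. -/
def snd : prod M N ⟶ N := ⟨LinearMap.snd (H k p) M N, fun _ _ hm => hm.2⟩

theorem inl_fst : inl M N ≫ fst M N = 𝟙 M := rfl
theorem inr_snd : inr M N ≫ snd M N = 𝟙 N := rfl
theorem inl_snd : inl M N ≫ snd M N = 0 := rfl
theorem inr_fst : inr M N ≫ fst M N = 0 := rfl

theorem fst_inl_add_snd_inr : fst M N ≫ inl M N + snd M N ≫ inr M N = 𝟙 (prod M N) :=
  hom_ext (LinearMap.ext fun x => Prod.ext (add_zero x.1) (zero_add x.2))

theorem projective_prod (hM : Module.Projective (H k p) M) (hN : Module.Projective (H k p) N) :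
    Module.Projective (H k p) (prod M N) :=
  inferInstanceAs (Module.Projective (H k p) (M × N))

variable {M N}

/-- The image of a graded map is spanned by images of homogeneous elements. This is the homogeneity
of the kernel that `isInternal_map` needs to grade the cokernel. -/
theorem ker_mkQ_range (f : M ⟶ N) :
    LinearMap.ker ((LinearMap.range f.toLin).mkQ.restrictScalars k) =
      Submodule.span k {y | ∃ n, ∃ m ∈ M.deg n, f.toLin m = y} := by
  ext y
  rw [LinearMap.mem_ker, LinearMap.restrictScalars_apply, Submodule.mkQ_apply,
    Submodule.Quotient.mk_eq_zero]
  constructor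
  · rintro ⟨m, rfl⟩
    refine internal_induction M.isInternal (P := fun m => f.toLin m ∈ Submodule.span k _) m
      (fun n v hv => Submodule.subset_span ⟨n, v, hv, rfl⟩) (fun a b ha hb => ?_)
    rw [map_add]
    exact add_mem ha hb
  · intro hy
    induction hy using Submodule.span_induction with
    | mem y hy => obtain ⟨n, m, -, rfl⟩ := hy; exact ⟨m, rfl⟩
    | zero => exact Submodule.zero_mem _
    | add a b _ _ ha hb => exact add_mem ha hb
    | smul c a _ ha => exact Submodule.smul_of_tower_mem _ c ha

theorem isInternal_coker (f : M ⟶ N) : DirectSum.IsInternal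
    (fun n => (N.deg n).map ((LinearMap.range f.toLin).mkQ.restrictScalars k)) := by
  refine isInternal_map N.isInternal ((LinearMap.range f.toLin).mkQ.restrictScalars k)
    (Submodule.mkQ_surjective (LinearMap.range f.toLin))
    {y | ∃ n, ∃ m ∈ M.deg n, f.toLin m = y} (ker_mkQ_range f) ?_
  rintro _ ⟨n, m, hm, rfl⟩
  exact ⟨n, f.map_deg n m hm⟩

/-- The cokernel of a morphism of graded modules. -/
def coker (f : M ⟶ N) : GMod k p where
  carrier := N ⧸ LinearMap.range f.toLin
  deg n := (N.deg n).map ((LinearMap.range f.toLin).mkQ.restrictScalars k)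
  isInternal := isInternal_coker f
  smul_mem := by
    rintro i j h hh _ ⟨m, hm, rfl⟩
    exact ⟨h • m, N.smul_mem i j h hh m hm, rfl⟩

/-- The projection onto the cokernel. -/
def cokerProj (f : M ⟶ N) : N ⟶ coker f :=
  ⟨(LinearMap.range f.toLin).mkQ, fun _ m hm => ⟨m, hm, rfl⟩⟩

/-- Right exact sequences `A → B → C → 0` of graded modules. -/
structure RightExact {A B C : GMod k p} (f : A ⟶ B) (g : B ⟶ C) : Prop where
  surj : Function.Surjective g.toLin
  exact : ∀ b, g.toLin b = 0 ↔ ∃ a, f.toLin a = b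

/-- Short exact sequences `0 → A → B → C → 0` of graded modules. -/
structure ShortExact {A B C : GMod k p} (f : A ⟶ B) (g : B ⟶ C) : Prop
    extends RightExact f g where
  inj : Function.Injective f.toLin

theorem rightExact_coker (f : M ⟶ N) : RightExact f (cokerProj f) where
  surj := Submodule.mkQ_surjective _
  exact _ := Submodule.Quotient.mk_eq_zero _

/-! ### Exactness and its effect on dimensions -/

variable {A B C : GMod k p} {f : A ⟶ B} {g : B ⟶ C}

theorem RightExact.comp_eq_zero (h : RightExact f g) : f ≫ g = 0 :=
  hom_ext (LinearMap.ext fun a => (h.exact _).2 ⟨a, rfl⟩)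

theorem RightExact.hom_ext (h : RightExact f g) {W : GMod k p} {a b : C ⟶ W}
    (hab : g ≫ a = g ≫ b) : a = b := by
  refine GMod.hom_ext (LinearMap.ext fun c => ?_)
  obtain ⟨y, rfl⟩ := h.surj c
  exact LinearMap.congr_fun (congrArg Hom.toLin hab) y

theorem RightExact.exists_preimage (h : RightExact f g) {n : ℤ} {c : C} (hc : c ∈ C.deg n) :
    ∃ b ∈ B.deg n, g.toLin b = c :=
  exists_homogeneous_preimage B.isInternal C.isInternal g.toLinBase g.map_deg hc (h.surj c)

theorem RightExact.exists_desc (h : RightExact f g) {W : GMod k p} (a : B ⟶ W)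
    (ha : f ≫ a = 0) : ∃ b : C ⟶ W, g ≫ b = a := by
  have hker : LinearMap.ker g.toLin ≤ LinearMap.ker a.toLin := by
    intro y hy
    obtain ⟨x, rfl⟩ := (h.exact y).1 hy
    exact LinearMap.congr_fun (congrArg Hom.toLin ha) x
  let l : C →ₗ[H k p] W := (LinearMap.ker g.toLin).liftQ a.toLin hker ∘ₗ
    (g.toLin.quotKerEquivOfSurjective h.surj).symm.toLinearMap
  have hl : ∀ y, l (g.toLin y) = a.toLin y := by
    intro y
    have : (g.toLin.quotKerEquivOfSurjective h.surj).symm (g.toLin y) =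
        Submodule.Quotient.mk y := by
      rw [LinearEquiv.symm_apply_eq]
      rfl
    change (LinearMap.ker g.toLin).liftQ a.toLin hker
      ((g.toLin.quotKerEquivOfSurjective h.surj).symm (g.toLin y)) = _
    rw [this]
    rfl
  refine ⟨⟨l, fun n c hc => ?_⟩, GMod.hom_ext (LinearMap.ext hl)⟩
  obtain ⟨y, hy, rfl⟩ := h.exists_preimage hc
  rw [hl]
  exact a.map_deg n y hy

/-- The dimension of a graded module, with degree `n` weighted by `w n`. -/
def wdim {G : Type*} [AddCommGroup G] (w : ℤ → G) (M : GMod k p) : G := weightedDim w M.deg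

/-- Exactness survives restriction to degree $n$, because preimages of homogeneous elements can be
chosen homogeneous; rank-nullity then applies. -/
theorem ShortExact.finrank_deg (h : ShortExact f g) (n : ℤ) :
    Module.finrank k (B.deg n) = Module.finrank k (A.deg n) + Module.finrank k (C.deg n) := by
  let fn : A.deg n →ₗ[k] B.deg n := f.toLinBase.restrict (f.map_deg n)
  let gn : B.deg n →ₗ[k] C.deg n := g.toLinBase.restrict (g.map_deg n)
  have hinj : Function.Injective fn := fun a b hab =>
    Subtype.ext (h.inj (congrArg Subtype.val hab))
  have hsurj : Function.Surjective gn := fun c => by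
    obtain ⟨b, hb, hbc⟩ := h.exists_preimage c.2
    exact ⟨⟨b, hb⟩, Subtype.ext hbc⟩
  have hker : LinearMap.ker gn = LinearMap.range fn := by
    ext b
    constructor
    · intro hb
      obtain ⟨a, ha⟩ := (h.exact b).1 (congrArg Subtype.val hb)
      have ha' : a ∈ A.deg n := mem_deg_of_map_mem A.isInternal B.isInternal f.toLinBase f.map_deg
        h.inj (by rw [Hom.toLinBase_apply, ha]; exact b.2)
      exact ⟨⟨a, ha'⟩, Subtype.ext ha⟩
    · rintro ⟨a, rfl⟩
      exact Subtype.ext ((h.exact _).2 ⟨a, rfl⟩)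
  rw [← gn.finrank_range_add_finrank_ker, hker, LinearMap.finrank_range_of_inj hinj,
    LinearMap.range_eq_top.2 hsurj, finrank_top, add_comm]

theorem ShortExact.wdim_eq {G : Type*} [AddCommGroup G] (w : ℤ → G) (h : ShortExact f g) :
    wdim w B = wdim w A + wdim w C := by
  rw [wdim, wdim, wdim, weightedDim, weightedDim, weightedDim, ← finsum_add_distrib
    (weightedDim_support w A.isInternal) (weightedDim_support w C.isInternal)]
  exact finsum_congr fun n => by rw [h.finrank_deg, add_smul]

theorem shortExact_prod (M N : GMod k p) : ShortExact (inl M N) (snd M N) where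
  surj y := ⟨(0, y), rfl⟩
  exact := by
    rintro ⟨x, y⟩
    constructor
    · intro h
      exact ⟨x, Prod.ext rfl (show 0 = y from (show y = 0 from h).symm)⟩
    · rintro ⟨a, ha⟩
      exact (congrArg Prod.snd ha).symm
  inj := LinearMap.inl_injective

theorem wdim_prod {G : Type*} [AddCommGroup G] (w : ℤ → G) (M N : GMod k p) :
    wdim w (prod M N) = wdim w M + wdim w N :=
  (shortExact_prod M N).wdim_eq w

/-- Statements about short exact sequences thereby cover isomorphisms, and produce triangles that
start at the zero module. -/
theorem shortExact_of_iso (e : M ≅ N) : ShortExact (0 : zeroObj k p ⟶ M) e.hom where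
  surj y := ⟨e.inv.toLin y, LinearMap.congr_fun (congrArg Hom.toLin e.inv_hom_id) y⟩
  exact b := by
    constructor
    · intro hb
      refine ⟨0, ?_⟩
      have h1 : e.inv.toLin (e.hom.toLin b) = b :=
        LinearMap.congr_fun (congrArg Hom.toLin e.hom_inv_id) b
      rw [map_zero, ← h1, hb, map_zero]
    · rintro ⟨a, rfl⟩
      exact map_zero _
  inj _ _ _ := Subsingleton.elim _ _

theorem wdim_of_subsingleton {G : Type*} [AddCommGroup G] (w : ℤ → G) (M : GMod k p)
    [Subsingleton M] : wdim w M = 0 := by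
  rw [wdim, weightedDim_of_basis w M.isInternal (Module.Basis.empty M : Module.Basis Empty k M)
    (fun _ => 0) (fun i => i.elim)]
  simp

theorem wdim_of_iso {G : Type*} [AddCommGroup G] (w : ℤ → G) (e : M ≅ N) :
    wdim w M = wdim w N := by
  rw [(shortExact_of_iso e).wdim_eq w, wdim_of_subsingleton, zero_add]

end Constructions

end GMod

/-! ### Graded dimension of projective modules -/

section Projective

variable {k : Type u} [Field k] {p : ℕ}

/-- If $X^p$ divides $X^jf$ in $k[X]$ and $j<p$, cancelling $X^j$ leaves at least one factor $X$ in
$f$. -/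
theorem exists_eq_xH_mul {j : ℕ} (hj : j < p) {h : H k p} (hh : xH k p ^ j * h = 0) :
    ∃ g, h = xH k p * g := by
  induction h using AdjoinRoot.induction_on with
  | ih f =>
    rw [xH, ← AdjoinRoot.mk_X, ← map_pow, ← map_mul, AdjoinRoot.mk_eq_zero] at hh
    obtain ⟨c, hc⟩ := hh
    obtain ⟨m, rfl⟩ := Nat.exists_eq_add_of_lt hj
    refine ⟨AdjoinRoot.mk _ (Polynomial.X ^ m * c), ?_⟩
    rw [xH, ← AdjoinRoot.mk_X, ← map_mul]
    congr 1
    apply mul_left_cancel₀ (pow_ne_zero j (Polynomial.X_ne_zero (R := k)))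
    rw [hc]
    ring

/-- A projective module is a retract of a free one. The coordinates of $m$ there are killed by
$X^j$, hence divisible by $X$, and the retraction carries the quotients back. -/
theorem exists_eq_xH_smul {P : Type u} [AddCommGroup P] [Module (H k p) P]
    [hP : Module.Projective (H k p) P] {j : ℕ} (hj : j < p) {m : P} (hm : xH k p ^ j • m = 0) :
    ∃ n : P, xH k p • n = m := by
  obtain ⟨s, hs⟩ := Module.projective_def'.1 hP
  have h1 : ∀ a, ∃ g, s m a = xH k p * g := by
    intro a
    apply exists_eq_xH_mul hj
    rw [← smul_eq_mul, ← Finsupp.smul_apply, ← map_smul, hm, map_zero, Finsupp.zero_apply]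
  choose g hg using h1
  refine ⟨(s m).sum fun a _ => g a • a, ?_⟩
  have h2 : Finsupp.linearCombination (H k p) id (s m) = m := LinearMap.congr_fun hs m
  conv_rhs => rw [← h2, Finsupp.linearCombination_apply]
  rw [Finsupp.sum, Finsupp.sum, Finset.smul_sum]
  exact Finset.sum_congr rfl fun a _ => by rw [hg, mul_smul, id]

theorem finrank_map_add_finrank_ker_inf {V W : Type*} [AddCommGroup V] [Module k V]
    [AddCommGroup W] [Module k W] [Module.Finite k V] (f : V →ₗ[k] W) (U : Submodule k V) :
    Module.finrank k (U.map f) + Module.finrank k (LinearMap.ker f ⊓ U : Submodule k V) =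
      Module.finrank k U := by
  rw [← (f.domRestrict U).finrank_range_add_finrank_ker, LinearMap.range_domRestrict]
  have h : (LinearMap.ker (f.domRestrict U)).map U.subtype = LinearMap.ker f ⊓ U := by
    ext x
    constructor
    · rintro ⟨y, hy, rfl⟩
      exact ⟨hy, y.2⟩
    · rintro ⟨hx, hxU⟩
      exact ⟨⟨x, hxU⟩, hx, rfl⟩
  rw [← h]
  exact congrArg _ (LinearEquiv.finrank_eq (Submodule.equivMapOfInjective U.subtype
    U.subtype_injective _)).symm

namespace GMod

variable (M : GMod k p)

/-- Multiplication by `X ^ j` on a graded module. -/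
def xPow (j : ℕ) : M →ₗ[k] M := Algebra.lsmul k k M (xH k p ^ j)

theorem xPow_apply (j : ℕ) (m : M) : M.xPow j m = xH k p ^ j • m := rfl

theorem xPow_mem (j : ℕ) {i : ℤ} {m : M} (hm : m ∈ M.deg i) : M.xPow j m ∈ M.deg (j + i) :=
  M.smul_mem _ _ _ (xH_pow_mem k p j) m hm

/-- The dimension of `X ^ j M_i`. -/
def rankPow (j : ℕ) (i : ℤ) : ℤ := Module.finrank k ((M.deg i).map (M.xPow j))

theorem rankPow_zero (i : ℤ) : M.rankPow 0 i = Module.finrank k (M.deg i) := by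
  have : M.xPow 0 = LinearMap.id := LinearMap.ext fun m => by simp [xPow_apply]
  rw [rankPow, this, Submodule.map_id]

theorem rankPow_p (i : ℤ) : M.rankPow p i = 0 := by
  have : M.xPow p = 0 := LinearMap.ext fun m => by simp [xPow_apply, xH_pow]
  rw [rankPow, this, Submodule.map_zero, finrank_bot, Nat.cast_zero]

theorem rankPow_eq_zero (j : ℕ) {i : ℤ} (h : M.deg i = ⊥) : M.rankPow j i = 0 := by
  rw [rankPow, h, Submodule.map_bot, finrank_bot, Nat.cast_zero]

theorem exists_eq_xH_smul_deg [Module.Projective (H k p) M] {j : ℕ} (hj : j < p) {i : ℤ} {m : M}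
    (hmi : m ∈ M.deg i) (hm : xH k p ^ j • m = 0) : ∃ n ∈ M.deg (i - 1), M.xPow 1 n = m := by
  -- Seen as a map from $M\{1\}$ to $M$, multiplication by $X$ preserves degrees.
  refine exists_homogeneous_preimage (M.shift 1).isInternal M.isInternal (M.xPow 1)
    (fun n v hv => ?_) hmi ?_
  · have h := M.xPow_mem 1 (i := n - 1) hv
    rwa [Nat.cast_one, add_sub_cancel] at h
  · obtain ⟨n, hn⟩ := exists_eq_xH_smul hj hm
    refine ⟨n, ?_⟩
    change xH k p ^ 1 • n = m
    rw [pow_one, hn]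

/-- The right side is the dimension of $(M/XM)_i$, the number of generators in degree $i$. The
kernel of $X^j$ on $M_i$ lies in $XM_{i-1}$, so applying $X^j$ does not change the codimension of
$XM_{i-1}$ in $M_i$. -/
theorem rankPow_sub [Module.Projective (H k p) M] {j : ℕ} (hj : j < p) (i : ℤ) :
    M.rankPow j i - M.rankPow (j + 1) (i - 1) = M.rankPow 0 i - M.rankPow 1 (i - 1) := by
  have h1 := finrank_map_add_finrank_ker_inf (M.xPow j) (M.deg i)
  have h2 := finrank_map_add_finrank_ker_inf (M.xPow j) ((M.deg (i - 1)).map (M.xPow 1))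
  have h3 : LinearMap.ker (M.xPow j) ⊓ (M.deg (i - 1)).map (M.xPow 1) =
      LinearMap.ker (M.xPow j) ⊓ M.deg i := by
    apply le_antisymm
    · refine inf_le_inf_left _ ?_
      rintro _ ⟨n, hn, rfl⟩
      simpa using M.xPow_mem 1 hn
    · rintro m ⟨hm, hmi⟩
      exact ⟨hm, M.exists_eq_xH_smul_deg hj hmi hm⟩
  have h4 : ((M.deg (i - 1)).map (M.xPow 1)).map (M.xPow j) =
      (M.deg (i - 1)).map (M.xPow (j + 1)) := by
    rw [← Submodule.map_comp]
    congr 1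
    ext m
    rw [LinearMap.comp_apply, xPow_apply, xPow_apply, xPow_apply, ← mul_smul, ← pow_add]
  rw [h3, h4] at h2
  rw [rankPow_zero, rankPow, rankPow, rankPow]
  omega

/-- Filter $M_i$ by the subspaces $X^jM_{i-j}$, ending at $X^pM_{i-p}=0$. The sum of the successive
codimensions telescopes. -/
theorem finrank_deg_of_projective [Module.Projective (H k p) M] (i : ℤ) :
    (Module.finrank k (M.deg i) : ℤ) =
      ∑ j ∈ Finset.range p, (M.rankPow 0 (i - j) - M.rankPow 1 (i - j - 1)) := by
  have h := Finset.sum_range_sub' (fun j => M.rankPow j (i - j)) p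
  rw [rankPow_p, sub_zero, Nat.cast_zero, sub_zero, rankPow_zero] at h
  rw [← h]
  refine Finset.sum_congr rfl fun j hj => ?_
  rw [← M.rankPow_sub (Finset.mem_range.1 hj), Nat.cast_succ, sub_sub]

/-- Weights that sum to zero over `p` consecutive degrees give projective modules dimension
zero. -/
theorem wdim_projective {G : Type*} [AddCommGroup G] (w : ℤ → G)
    (hw : ∀ i, ∑ j ∈ Finset.range p, w (i + j) = 0) [Module.Projective (H k p) M] :
    wdim w M = 0 := by
  -- The number of generators of $M$ in degree $i$. Each generator contributes the weights of $p$
  -- consecutive degrees, so the aim is to regroup the sum by generators.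
  let c : ℤ → ℤ := fun i => M.rankPow 0 i - M.rankPow 1 (i - 1)
  have hfin : ∀ j : ℕ, (Function.support fun i : ℤ => c (i - j) • w i).Finite := by
    intro j
    have h0 := finite_deg_ne_bot M.isInternal
    refine ((h0.image (· + (j : ℤ))).union (h0.image (· + ((j : ℤ) + 1)))).subset fun i hi => ?_
    by_contra h
    rw [Set.mem_union, not_or] at h
    have h1 : M.deg (i - j) = ⊥ := by
      by_contra hne
      exact h.1 ⟨i - j, hne, by simp⟩
    have h2 : M.deg (i - j - 1) = ⊥ := by
      by_contra hne
      exact h.2 ⟨i - j - 1, hne, by simp⟩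
    refine hi ?_
    change c (i - j) • w i = 0
    rw [show c (i - j) = 0 - 0 from congrArg₂ (· - ·) (M.rankPow_eq_zero _ h1)
      (M.rankPow_eq_zero _ h2),
      sub_zero, zero_smul]
  have h1 : ∀ i, Module.finrank k (M.deg i) • w i =
      ∑ j ∈ Finset.range p, c (i - j) • w i := by
    intro i
    rw [← Finset.sum_smul, ← M.finrank_deg_of_projective, natCast_zsmul]
  rw [wdim, weightedDim, finsum_congr h1, finsum_sum_comm _ _ fun j _ => hfin j]
  -- Reindexing by the degree of the generator makes the $p$ consecutive weights appear with the
  -- common factor $c(i)$.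
  have h2 : ∀ j : ℕ, ∑ᶠ i : ℤ, c (i - j) • w i = ∑ᶠ i : ℤ, c i • w (i + j) := by
    intro j
    rw [← finsum_comp_equiv (Equiv.addRight (j : ℤ))]
    simp
  have hfin' : ∀ j : ℕ, (Function.support fun i : ℤ => c i • w (i + j)).Finite := by
    intro j
    refine ((hfin j).image (fun i => i - (j : ℤ))).subset fun i hi => ⟨i + j, ?_, by simp⟩
    simpa using hi
  rw [Finset.sum_congr rfl fun j _ => h2 j, ← finsum_sum_comm _ _ fun j _ => hfin' j]
  rw [finsum_congr fun i => by rw [← Finset.smul_sum, hw i, smul_zero]]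
  exact finsum_zero

end GMod

end Projective

/-! ### A homogeneous basis of `H` and the derivation `d/dX` -/

section Derivation

variable (k : Type u) [Field k] (p : ℕ)

theorem exists_basis_H : ∃ b : Module.Basis (Fin p) k (H k p), ∀ i, b i = xH k p ^ (i : ℕ) := by
  let pb := AdjoinRoot.powerBasis'
    (Polynomial.monic_X_pow p : (Polynomial.X ^ p : Polynomial k).Monic)
  have hdim : pb.dim = p := Polynomial.natDegree_X_pow p
  refine ⟨pb.basis.reindex (finCongr hdim), fun i => ?_⟩
  rw [Module.Basis.reindex_apply, pb.basis_eq_pow]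
  rfl

/-- The derivative descends to $k[X]/(X^p)$ because the derivative $pX^{p-1}$ of $X^p$ vanishes in
characteristic $p$. At $n=0$ the truncated exponent is harmless, since the coefficient is zero. -/
theorem exists_derivation_H [CharP k p] : ∃ d : H k p →ₗ[k] H k p,
    ∀ n : ℕ, d (xH k p ^ n) = (n : k) • xH k p ^ (n - 1) := by
  obtain ⟨b, hb⟩ := exists_basis_H k p
  let d : H k p →ₗ[k] H k p := b.constr k fun i => ((i : ℕ) : k) • xH k p ^ ((i : ℕ) - 1)
  refine ⟨d, fun n => ?_⟩
  rcases lt_trichotomy n p with h | rfl | h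
  · have h1 := b.constr_basis k (fun i => ((i : ℕ) : k) • xH k p ^ ((i : ℕ) - 1)) ⟨n, h⟩
    rwa [hb] at h1
  · rw [xH_pow, map_zero, CharP.cast_eq_zero, zero_smul]
  · rw [pow_eq_zero_of_le h.le (xH_pow k p), map_zero,
      pow_eq_zero_of_le (Nat.le_sub_one_of_lt h) (xH_pow k p), smul_zero]

theorem exists_derivation_H_deg [CharP k p] : ∃ d : H k p →ₗ[k] H k p,
    (∀ n, ∀ h ∈ hDeg k p n, d h ∈ hDeg k p (n - 1)) ∧
      ∀ h, d (xH k p * h) = xH k p * d h + h := by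
  obtain ⟨d, hd⟩ := exists_derivation_H k p
  refine ⟨d, fun n h hh => ?_, fun h => ?_⟩
  · induction hh using Submodule.span_induction with
    | mem h hh =>
      obtain ⟨m, rfl, rfl⟩ := hh
      rw [hd]
      cases m with
      | zero => simp
      | succ m =>
        refine Submodule.smul_mem _ _ ?_
        simpa using xH_pow_mem k p m
    | zero => rw [map_zero]; exact Submodule.zero_mem _
    | add a b _ _ ha hb => rw [map_add]; exact add_mem ha hb
    | smul c a _ ha => rw [map_smul]; exact Submodule.smul_mem _ _ ha
  · have hh : h ∈ Submodule.span k (Set.range fun n : ℕ => xH k p ^ n) :=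
      span_xH_pow k p ▸ Submodule.mem_top
    induction hh using Submodule.span_induction with
    | mem h hh =>
      obtain ⟨n, rfl⟩ := hh
      dsimp only
      rw [← pow_succ', hd, hd, mul_smul_comm, Nat.add_sub_cancel]
      cases n with
      | zero => simp
      | succ n =>
        rw [Nat.add_sub_cancel, ← pow_succ', Nat.cast_succ (n + 1), add_smul, one_smul]
    | zero => simp
    | add a b _ _ ha hb => rw [mul_add, map_add, ha, hb, map_add, mul_add]; abel
    | smul c a _ ha => rw [mul_smul_comm, map_smul, ha, map_smul, mul_smul_comm, smul_add]

theorem integralH_ne_zero [Fact p.Prime] : integralH k p ≠ 0 := by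
  obtain ⟨b, hb⟩ := exists_basis_H k p
  have := b.ne_zero ⟨p - 1, Nat.sub_lt (Fact.out : p.Prime).pos one_pos⟩
  rwa [hb] at this

/-- `M` has an operator `d` of degree `-1` with `d X - X d = 1`. -/
def GMod.HasDerivation {k : Type u} [Field k] {p : ℕ} (M : GMod k p) : Prop :=
  ∃ d : M →ₗ[k] M, (∀ n, ∀ m ∈ M.deg n, d m ∈ M.deg (n - 1)) ∧
    ∀ m, d (xH k p • m) = xH k p • d m + m

theorem GMod.hasDerivation_regular [Fact p.Prime] [CharP k p] :
    (GMod.regular k p).HasDerivation :=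
  exists_derivation_H_deg k p

variable {k p}

theorem GMod.HasDerivation.shift {M : GMod k p} (h : M.HasDerivation) (n : ℤ) :
    (M.shift n).HasDerivation := by
  obtain ⟨d, hd, hx⟩ := h
  refine ⟨d, fun i m hm => ?_, hx⟩
  have := hd _ m hm
  change d m ∈ M.deg (i - 1 - n)
  rwa [sub_right_comm]

variable [Fact p.Prime] [CharP k p]

theorem GMod.HasDerivation.tensor {M : GMod k p} (h : M.HasDerivation) (N : GMod k p) :
    (GMod.tensor M N).HasDerivation := by
  obtain ⟨d, hd, hx⟩ := h
  let D : GMod.tensor M N →ₗ[k] GMod.tensor M N := LinearMap.rTensor N d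
  have hD : ∀ m n, D (GMod.tmul m n) = GMod.tmul (d m) n := fun _ _ => rfl
  refine ⟨D, fun i t ht => ?_, fun t => ?_⟩
  · induction ht using Submodule.span_induction with
    | mem t ht =>
      obtain ⟨a, b, rfl, v, hv, w, hw, rfl⟩ := ht
      exact tmul_mem_tensorDeg (by ring) (hd _ _ hv) hw
    | zero => exact (map_zero D).symm ▸ Submodule.zero_mem _
    | add a b _ _ ha hb => exact (map_add D a b).symm ▸ add_mem ha hb
    | smul c a _ ha => exact (map_smul D c a).symm ▸ Submodule.smul_mem _ _ ha
  · induction t using GMod.tensor_induction with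
    | h0 => rw [smul_zero, map_zero, smul_zero, add_zero]
    | ha a b ha hb => rw [smul_add, map_add, ha, hb, map_add, smul_add]; abel
    | ht m n =>
      have hadd : ∀ a b : M, GMod.tmul (a + b) n = GMod.tmul a n + GMod.tmul b n :=
        fun a b => TensorProduct.add_tmul (R := k) a b n
      rw [GMod.xH_smul_tmul, map_add, hD, hD, hD, hx, GMod.xH_smul_tmul, hadd]
      abel

end Derivation

namespace GMod

/-! ### Extension of morphisms into modules with a derivation -/

section Extension

variable {k : Type u} [Field k] {p : ℕ}

/-- The commutator of linear maps with `X`. -/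
def commX (M N : GMod k p) : Module.End k (M →ₗ[k] N) :=
  LinearMap.llcomp k M N N (N.xPow 1) - LinearMap.lcomp k N (M.xPow 1)

theorem commX_apply (M N : GMod k p) (g : M →ₗ[k] N) (m : M) :
    commX M N g m = xH k p • g m - g (xH k p • m) := by
  change xH k p ^ 1 • g m - g (xH k p ^ 1 • m) = _
  rw [pow_one]

/-- The commutator is $l-r$, with $l$ and $r$ the commuting operators of composition with $X$ on
either side. In characteristic $p$ its $p$-th power is $l^p+(-1)^pr^p$, and $X^p=0$ kills both
terms. -/
theorem commX_pow_p [Fact p.Prime] [CharP k p] (M N : GMod k p) : commX M N ^ p = 0 := by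
  let l : Module.End k (M →ₗ[k] N) := LinearMap.llcomp k M N N (N.xPow 1)
  let r : Module.End k (M →ₗ[k] N) := LinearMap.lcomp k N (M.xPow 1)
  have hl : ∀ (n : ℕ) g m, (l ^ n) g m = xH k p ^ n • g m := by
    intro n
    induction n with
    | zero => intro g m; simp
    | succ n ih =>
      intro g m
      rw [pow_succ', Module.End.mul_apply]
      change xH k p ^ 1 • (l ^ n) g m = _
      rw [ih, ← mul_smul, pow_one, pow_succ']
  have hr : ∀ (n : ℕ) g m, (r ^ n) g m = g (xH k p ^ n • m) := by
    intro n
    induction n with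
    | zero => intro g m; simp
    | succ n ih =>
      intro g m
      rw [pow_succ', Module.End.mul_apply]
      change (r ^ n) g (xH k p ^ 1 • m) = _
      rw [ih, ← mul_smul, pow_one, pow_succ]
  have hl0 : l ^ p = 0 := LinearMap.ext fun g => LinearMap.ext fun m => by
    rw [hl, xH_pow, zero_smul]; rfl
  have hr0 : r ^ p = 0 := LinearMap.ext fun g => LinearMap.ext fun m => by
    rw [hr, xH_pow, zero_smul, map_zero]; rfl
  have hc' : Commute l r := LinearMap.ext fun g => LinearMap.ext fun m => rfl
  have hc : Commute l (-r) := hc'.neg_right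
  have hr1 : (-r) ^ p = (-1) ^ p * r ^ p := neg_pow r p
  obtain ⟨s, hs⟩ := hc.exists_add_pow_prime_eq (Fact.out : p.Prime)
  have hp : (p : Module.End k (M →ₗ[k] N)) = 0 := by
    rw [← map_natCast (algebraMap k (Module.End k (M →ₗ[k] N))), CharP.cast_eq_zero, map_zero]
  change (l - r) ^ p = 0
  rw [sub_eq_add_neg, hs, hl0, hr1, hr0, hp]
  simp

variable {A B I : GMod k p}

/-- From $dX-Xd=1$, one commutator of $d\circ s$ is $d\circ[X,s]-s$; each further commutator
contributes one more copy of the last term. -/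
theorem commX_pow_comp {d : I →ₗ[k] I} (hd : ∀ m, d (xH k p • m) = xH k p • d m + m)
    (n : ℕ) (s : B →ₗ[k] I) :
    (commX B I ^ (n + 1)) (d ∘ₗ s) =
      d ∘ₗ (commX B I ^ (n + 1)) s - ((n + 1 : ℕ) : k) • (commX B I ^ n) s := by
  induction n generalizing s with
  | zero =>
    ext m
    simp only [zero_add, pow_one, pow_zero, Nat.cast_one, one_smul, Module.End.one_apply,
      LinearMap.sub_apply, LinearMap.comp_apply, commX_apply, map_sub, hd]
    abel
  | succ n ih =>
    have h1 : commX B I (d ∘ₗ s) = d ∘ₗ commX B I s - s := by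
      ext m
      simp only [LinearMap.sub_apply, LinearMap.comp_apply, commX_apply, map_sub, hd]
      abel
    have h2 : ∀ (m : ℕ) (t : B →ₗ[k] I), (commX B I ^ (m + 1)) t = (commX B I ^ m) (commX B I t) :=
      fun m t => by rw [pow_succ, Module.End.mul_apply]
    rw [h2 (n + 1), h1, map_sub, ih, h2 (n + 1), ← h2 n s, sub_sub, Nat.cast_succ (n + 1), add_smul,
      one_smul]

theorem commX_mem {s : B →ₗ[k] I} (hs : ∀ n, ∀ b ∈ B.deg n, s b ∈ I.deg n) {n : ℤ} {b : B}
    (hb : b ∈ B.deg n) : commX B I s b ∈ I.deg (1 + n) := by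
  rw [commX_apply]
  exact sub_mem (I.xH_smul_mem (hs _ _ hb)) (hs _ _ (B.xH_smul_mem hb))

theorem commX_comp (u : A ⟶ B) (s : B →ₗ[k] I) :
    commX B I s ∘ₗ u.toLinBase = commX A I (s ∘ₗ u.toLinBase) := by
  ext a
  simp only [LinearMap.comp_apply, commX_apply, Hom.toLinBase_apply, map_smul]

theorem commX_toLinBase (f : A ⟶ I) : commX A I f.toLinBase = 0 := by
  ext a
  simp only [commX_apply, Hom.toLinBase_apply, map_smul, sub_self, LinearMap.zero_apply]

/-- Modules with a derivation are injective. -/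
theorem HasDerivation.exists_extension [Fact p.Prime] [CharP k p] (hI : I.HasDerivation)
    {u : A ⟶ B} (hu : Function.Injective u.toLin) (f : A ⟶ I) : ∃ e : B ⟶ I, u ≫ e = f := by
  obtain ⟨d, hd, hx⟩ := hI
  -- Being $H$-linear means being killed by the commutator with $X$. Any graded $k$-linear extension
  -- is killed by its $p$-th power; the induction lowers this exponent to $1$.
  have key : ∀ j < p, ∃ s : B →ₗ[k] I, (∀ n, ∀ b ∈ B.deg n, s b ∈ I.deg n) ∧
      s ∘ₗ u.toLinBase = f.toLinBase ∧ (commX B I ^ (p - j)) s = 0 := by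
    intro j
    induction j with
    | zero =>
      intro _
      obtain ⟨s, hs, hsf⟩ := exists_graded_extension A.isInternal B.isInternal u.toLinBase
        u.map_deg hu f.toLinBase f.map_deg
      exact ⟨s, hs, hsf, by rw [Nat.sub_zero, commX_pow_p, LinearMap.zero_apply]⟩
    | succ j ih =>
      intro hj
      obtain ⟨s, hs, hsf, h0⟩ := ih (by omega)
      obtain ⟨n, hn⟩ : ∃ n, p - (j + 1) = n + 1 := ⟨p - (j + 1) - 1, by omega⟩
      have hn' : p - j = n + 1 + 1 := by omega
      have hc : ((n + 1 : ℕ) : k) ≠ 0 := by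
        rw [Ne, CharP.cast_eq_zero_iff k p]
        exact fun h => absurd (Nat.le_of_dvd (Nat.succ_pos n) h) (by omega)
      rw [hn'] at h0
      -- With $C$ the commutator and $C^{n+2}s=0$, `commX_pow_comp` gives $C^{n+1}(d\circ
      -- Cs)=-(n+1)C^{n+1}s$, so this correction cancels $C^{n+1}s$; $n+1<p$ is invertible. The
      -- extension property persists because $Cs$ vanishes on the image of the $H$-linear map $u$.
      refine ⟨s + ((n + 1 : ℕ) : k)⁻¹ • (d ∘ₗ commX B I s), fun i b hb => ?_, ?_, ?_⟩
      · refine add_mem (hs _ _ hb) (Submodule.smul_mem _ _ ?_)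
        have h := hd _ _ (commX_mem hs hb)
        rwa [add_sub_cancel_left] at h
      · rw [LinearMap.add_comp, LinearMap.smul_comp, LinearMap.comp_assoc, commX_comp, hsf,
          commX_toLinBase, LinearMap.comp_zero, smul_zero, add_zero]
      · rw [hn, map_add, map_smul, commX_pow_comp hx, ← Module.End.mul_apply (commX B I ^ (n + 1)),
          ← pow_succ, h0, LinearMap.comp_zero, zero_sub, ← Module.End.mul_apply, ← pow_succ,
          smul_neg, inv_smul_smul₀ hc, add_neg_cancel]
  have hp := (Fact.out : p.Prime).pos
  obtain ⟨s, hs, hsf, h0⟩ := key (p - 1) (by omega)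
  rw [show p - (p - 1) = 1 by omega, pow_one] at h0
  refine ⟨⟨linearOfX s fun b => ?_, hs⟩, ?_⟩
  · have h := commX_apply B I s b
    rw [h0, LinearMap.zero_apply] at h
    exact (sub_eq_zero.1 h.symm).symm
  · exact hom_ext (LinearMap.ext fun a => LinearMap.congr_fun hsf a)

end Extension

/-! ### Pushouts along the embedding into an injective module -/

section Pushouts

variable {k : Type u} [Field k] {p : ℕ}

/-- The pushout of `u` and `j`, when `u` extends `j` along `e`. -/
theorem ShortExact.isPushout {X Y Z I : GMod k p} {u : X ⟶ Y} {v : Y ⟶ Z} (h : ShortExact u v)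
    (j : X ⟶ I) (e : Y ⟶ I) (he : u ≫ e = j) :
    IsPushout u j (v ≫ inl Z I + e ≫ inr Z I) (inr Z I) := by
  -- Since $j$ factors through $u$, the difference of the two legs, compared along $e$, vanishes on
  -- $X$ and descends to $Z$. It is the component on $Z$ of the induced map.
  have hD : ∀ s : Limits.PushoutCocone u j, ∃ b : Z ⟶ s.pt, v ≫ b = s.inl - e ≫ s.inr :=
    fun s => h.exists_desc _ (by
      rw [Preadditive.comp_sub, ← Category.assoc, he, s.condition, sub_self])
  choose D hD using hD
  refine ⟨⟨?_⟩, ⟨Limits.PushoutCocone.IsColimit.mk _ (fun s => fst Z I ≫ D s + snd Z I ≫ s.inr)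
    (fun s => ?_) (fun s => ?_) (fun s m hl hr => ?_)⟩⟩
  · rw [Preadditive.comp_add, ← Category.assoc, ← Category.assoc, h.comp_eq_zero, he,
      Limits.zero_comp, zero_add]
  · simp only [Preadditive.add_comp, Preadditive.comp_add, Category.assoc]
    rw [← Category.assoc (inl Z I), ← Category.assoc (inl Z I), ← Category.assoc (inr Z I),
      ← Category.assoc (inr Z I), inl_fst, inl_snd, inr_fst, inr_snd]
    simp [hD]
  · rw [Preadditive.comp_add, ← Category.assoc, ← Category.assoc, inr_fst, inr_snd]
    simp
  · have hm : inl Z I ≫ m = D s := by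
      apply h.toRightExact.hom_ext
      rw [hD, ← hl, ← hr]
      simp [Preadditive.add_comp]
    rw [← hm, ← hr, ← Category.assoc, ← Category.assoc, ← Preadditive.add_comp, fst_inl_add_snd_inr,
      Category.id_comp]

/-- The cokernel of `(f, -j)` is a pushout. -/
theorem isPushout_coker {X Y I : GMod k p} (f : X ⟶ Y) (j : X ⟶ I) :
    IsPushout f j (inl Y I ≫ cokerProj (f ≫ inl Y I - j ≫ inr Y I))
      (inr Y I ≫ cokerProj (f ≫ inl Y I - j ≫ inr Y I)) := by
  let w := f ≫ inl Y I - j ≫ inr Y I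
  have hw : RightExact w (cokerProj w) := rightExact_coker w
  have hz : ∀ s : Limits.PushoutCocone f j, w ≫ (fst Y I ≫ s.inl + snd Y I ≫ s.inr) = 0 := by
    intro s
    have h1 : w ≫ fst Y I = f := by
      rw [Preadditive.sub_comp, Category.assoc, Category.assoc, inl_fst, inr_fst]; simp
    have h2 : w ≫ snd Y I = -j := by
      rw [Preadditive.sub_comp, Category.assoc, Category.assoc, inl_snd, inr_snd]; simp
    rw [Preadditive.comp_add, ← Category.assoc, ← Category.assoc, h1, h2, s.condition]
    simp
  refine ⟨⟨?_⟩, ⟨Limits.PushoutCocone.IsColimit.mk _ (fun s => ?_) (fun s => ?_) (fun s => ?_)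
    (fun s m hl hr => ?_)⟩⟩
  · rw [← sub_eq_zero, ← Category.assoc, ← Category.assoc, ← Preadditive.sub_comp]
    exact hw.comp_eq_zero
  · exact (hw.exists_desc _ (hz s)).choose
  · rw [Category.assoc, (hw.exists_desc _ (hz s)).choose_spec, Preadditive.comp_add,
      ← Category.assoc, ← Category.assoc, inl_fst, inl_snd]
    simp
  · rw [Category.assoc, (hw.exists_desc _ (hz s)).choose_spec, Preadditive.comp_add,
      ← Category.assoc, ← Category.assoc, inr_fst, inr_snd]
    simp
  · apply hw.hom_ext
    have h1 : cokerProj w ≫ m = (fst Y I ≫ inl Y I + snd Y I ≫ inr Y I) ≫ cokerProj w ≫ m := by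
      rw [fst_inl_add_snd_inr, Category.id_comp]
    rw [(hw.exists_desc _ (hz s)).choose_spec, ← hl, ← hr, h1]
    simp only [Preadditive.add_comp, Category.assoc, w]

variable [Fact p.Prime] [CharP k p]

/-- A linear form that does not vanish on $\Lambda$ recovers $m$, up to a nonzero scalar, from
$\Lambda\otimes m$. -/
theorem integralEmb_injective (M : GMod k p) : Function.Injective (integralEmb M).toLin := by
  obtain ⟨l, hl⟩ := Module.Projective.exists_dual_ne_zero k (integralH_ne_zero k p)
  let F : tensor ((regular k p).shift (1 - p)) M →ₗ[k] M :=
    (TensorProduct.lid k M).toLinearMap ∘ₗ LinearMap.rTensor M l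
  have hF : ∀ m, F ((integralEmb M).toLin m) = l (integralH k p) • m := fun _ => rfl
  intro a b hab
  have h := congrArg F hab
  rw [hF, hF] at h
  exact smul_right_injective M hl h

/-- The projective module `H ⊗ M` into which `M` embeds. -/
abbrev cover (M : GMod k p) : GMod k p := tensor ((regular k p).shift (1 - p)) M

theorem projective_cover (M : GMod k p) : Module.Projective (H k p) (cover M) :=
  projective_regular_tensor M

theorem hasDerivation_cover (M : GMod k p) : (cover M).HasDerivation :=
  ((hasDerivation_regular k p).shift _).tensor M

/-- Cones have the weighted dimension predicted by the triangle, for weights vanishing on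
projective modules. -/
theorem wdim_cone {G : Type*} [AddCommGroup G] (w : ℤ → G)
    (hw : ∀ i, ∑ j ∈ Finset.range p, w (i + j) = 0) {X Y C : GMod k p} {f : X ⟶ Y} {g : Y ⟶ C}
    {f' : cover X ⟶ C} (h : IsPushout f (integralEmb X) g f') :
    wdim w Y = wdim w X + wdim w C := by
  -- Injectivity comes from the second component alone, which is minus the embedding of $X$ into its
  -- cover.
  have hse : ShortExact (f ≫ inl Y (cover X) - integralEmb X ≫ inr Y (cover X))
      (cokerProj (f ≫ inl Y (cover X) - integralEmb X ≫ inr Y (cover X))) :=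
    { toRightExact := rightExact_coker _
      inj := fun a b hab => integralEmb_injective X (neg_injective (by
        have h2 : ∀ c, (snd Y (cover X)).toLin
            ((f ≫ inl Y (cover X) - integralEmb X ≫ inr Y (cover X)).toLin c) =
            -(integralEmb X).toLin c := fun c => zero_sub ((integralEmb X).toLin c)
        rw [← h2, ← h2, hab])) }
  have h1 := hse.wdim_eq w
  have h2 := wdim_of_iso w (h.isoIsPushout _ _ (isPushout_coker f (integralEmb X)))
  have := projective_cover X
  rw [wdim_prod, wdim_projective (cover X) w hw, add_zero, ← h2] at h1
  exact h1

end Pushouts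

end GMod

/-! ### The stable category -/

section StableLemmas

variable {k : Type u} [Field k] {p : ℕ}

namespace GMod

theorem projective_zeroObj : Module.Projective (H k p) (zeroObj k p) :=
  inferInstanceAs (Module.Projective (H k p) PUnit.{u + 1})

/-- Morphisms that factor through a projective module. -/
def Null {M N : GMod k p} (f : M ⟶ N) : Prop :=
  ∃ P : GMod k p, Module.Projective (H k p) P ∧ ∃ (a : M ⟶ P) (b : P ⟶ N), f = a ≫ b

variable {M N L : GMod k p}

theorem Null.zero : Null (0 : M ⟶ N) := ⟨zeroObj k p, projective_zeroObj, 0, 0, by simp⟩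

theorem Null.neg {f : M ⟶ N} (h : Null f) : Null (-f) := by
  obtain ⟨P, hP, a, b, rfl⟩ := h
  exact ⟨P, hP, -a, b, by simp⟩

/-- The sum factors through the direct sum of the two projectives. -/
theorem Null.add {f g : M ⟶ N} (hf : Null f) (hg : Null g) : Null (f + g) := by
  obtain ⟨P, hP, a, b, rfl⟩ := hf
  obtain ⟨Q, hQ, c, d, rfl⟩ := hg
  refine ⟨prod P Q, projective_prod P Q hP hQ, a ≫ inl P Q + c ≫ inr P Q,
    fst P Q ≫ b + snd P Q ≫ d, ?_⟩
  exact hom_ext (LinearMap.ext fun m => by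
    change b.toLin (a.toLin m) + d.toLin (c.toLin m) =
      b.toLin (a.toLin m + 0) + d.toLin (0 + c.toLin m)
    rw [add_zero, zero_add])

theorem Null.comp_left (g : L ⟶ M) {f : M ⟶ N} (h : Null f) : Null (g ≫ f) := by
  obtain ⟨P, hP, a, b, rfl⟩ := h
  exact ⟨P, hP, g ≫ a, b, (Category.assoc _ _ _).symm⟩

theorem Null.comp_right {f : M ⟶ N} (h : Null f) (g : N ⟶ L) : Null (f ≫ g) := by
  obtain ⟨P, hP, a, b, rfl⟩ := h
  exact ⟨P, hP, a, b ≫ g, Category.assoc _ _ _⟩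

theorem null_of_projective (hP : Module.Projective (H k p) N) (f : M ⟶ N) : Null f :=
  ⟨N, hP, f, 𝟙 N, (Category.comp_id f).symm⟩

/-- A module whose identity factors through a projective module is projective. -/
theorem Null.projective (h : Null (𝟙 M)) : Module.Projective (H k p) M := by
  obtain ⟨P, hP, a, b, hab⟩ := h
  exact Module.Projective.of_split a.toLin b.toLin (congrArg Hom.toLin hab).symm

end GMod

open GMod

/-- The quotient construction makes no identifications beyond the relation itself once that relation
is a congruence; equality of stable morphisms is then exactly nullity of the difference. -/
instance : Congruence (stableRel k p) where
  comp_left f g g' h := by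
    have h' : Null (g - g') := h
    have := h'.comp_left f
    rwa [Preadditive.comp_sub] at this
  comp_right g h := by
    have h' : Null (_ - _) := h
    have := h'.comp_right g
    rwa [Preadditive.sub_comp] at this
  equivalence :=
    { refl := fun f => by
        have h : Null (f - f) := by rw [sub_self]; exact Null.zero
        exact h
      symm := fun {f g} h => by
        have h' : Null (f - g) := h
        have := h'.neg
        rwa [neg_sub] at this
      trans := fun {f g l} h h' => by
        have h1 : Null (f - g) := h
        have h2 : Null (g - l) := h'
        have := h1.add h2
        rwa [sub_add_sub_cancel] at this }

theorem toStable_map_eq_iff {M N : GMod k p} (f g : M ⟶ N) :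
    (toStable k p).map f = (toStable k p).map g ↔ Null (f - g) :=
  CategoryTheory.Quotient.functor_map_eq_iff (stableRel k p) f g

/-- Stably inverse morphisms force equal weighted dimensions: `M` is a direct summand of `N ⊕ P`
with projective complement. -/
theorem wdim_of_null {G : Type*} [AddCommGroup G] (w : ℤ → G)
    (hw : ∀ i, ∑ j ∈ Finset.range p, w (i + j) = 0) {M N : GMod k p} (f : M ⟶ N) (g : N ⟶ M)
    (hfg : Null (f ≫ g - 𝟙 M)) (hgf : Null (g ≫ f - 𝟙 N)) : wdim w M = wdim w N := by
  obtain ⟨P, hP, a, b, hab⟩ := hfg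
  -- Writing $f\circ$-then-$g$ minus the identity as $a$ followed by $b$, the sign in `r` makes the
  -- composite of `i` and `r` equal to the identity on the nose.
  let i : M ⟶ prod N P := f ≫ inl N P + a ≫ inr N P
  let r : prod N P ⟶ M := fst N P ≫ g - snd N P ≫ b
  have hir : i ≫ r = 𝟙 M := by
    have h : i ≫ r = f ≫ g - a ≫ b := hom_ext (LinearMap.ext fun m => by
      change g.toLin (f.toLin m + 0) - b.toLin (0 + a.toLin m) = _
      rw [add_zero, zero_add]
      rfl)
    rw [h, ← hab, sub_sub_cancel]
  -- The complementary idempotent has one term that is null because `g ≫ f` is stably the identity;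
  -- the remaining terms factor through $P$.
  have he : Null (𝟙 (prod N P) - r ≫ i) := by
    have h1 : 𝟙 (prod N P) - r ≫ i = -(fst N P ≫ (g ≫ f - 𝟙 N) ≫ inl N P) +
        ((snd N P ≫ b ≫ f ≫ inl N P) +
          ((snd N P - fst N P ≫ g ≫ a + snd N P ≫ b ≫ a) ≫ inr N P)) := by
      rw [← fst_inl_add_snd_inr]
      simp only [i, r, Preadditive.comp_add, Preadditive.add_comp, Preadditive.sub_comp,
        Preadditive.comp_sub, Category.assoc, Category.id_comp]
      abel
    rw [h1]
    exact ((hgf.comp_right _).comp_left _).neg.add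
      (((null_of_projective hP _).comp_right _).add ((null_of_projective hP _).comp_right _))
  have hq := rightExact_coker i
  -- The complement of $M$ is a retract along that null idempotent, so its identity is null and it
  -- is projective.
  have hQ : Module.Projective (H k p) (coker i) := by
    obtain ⟨s, hs⟩ := hq.exists_desc (𝟙 (prod N P) - r ≫ i) (by
      rw [Preadditive.comp_sub, ← Category.assoc, hir, Category.id_comp, Category.comp_id,
        sub_self])
    have hπ : (𝟙 (prod N P) - r ≫ i) ≫ cokerProj i = cokerProj i := by
      rw [Preadditive.sub_comp, Category.assoc, hq.comp_eq_zero, Limits.comp_zero, sub_zero,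
        Category.id_comp]
    have h1 : 𝟙 (coker i) = s ≫ (𝟙 (prod N P) - r ≫ i) ≫ cokerProj i := by
      apply hq.hom_ext
      rw [hπ, ← Category.assoc, hs, hπ, Category.comp_id]
    apply Null.projective
    rw [h1]
    exact (he.comp_right _).comp_left _
  have hse : ShortExact i (cokerProj i) :=
    { toRightExact := hq
      inj := fun x y hxy => by
        have h2 : ∀ c, r.toLin (i.toLin c) = c :=
          fun c => LinearMap.congr_fun (congrArg Hom.toLin hir) c
        rw [← h2 x, ← h2 y, hxy] }
  have h := hse.wdim_eq w
  rw [wdim_prod, wdim_projective P w hw, wdim_projective (coker i) w hw, add_zero, add_zero] at h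
  exact h.symm

theorem wdim_of_stableIso {G : Type*} [AddCommGroup G] (w : ℤ → G)
    (hw : ∀ i, ∑ j ∈ Finset.range p, w (i + j) = 0) {M N : StableCat k p} (e : M ≅ N) :
    wdim w M.as = wdim w N.as := by
  obtain ⟨f, hf⟩ := (toStable k p).map_surjective (X := M.as) (Y := N.as) e.hom
  obtain ⟨g, hg⟩ := (toStable k p).map_surjective (X := N.as) (Y := M.as) e.inv
  refine wdim_of_null w hw f g ?_ ?_
  · rw [← toStable_map_eq_iff, Functor.map_comp, hf, hg, CategoryTheory.Functor.map_id]
    exact e.hom_inv_id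
  · rw [← toStable_map_eq_iff, Functor.map_comp, hf, hg, CategoryTheory.Functor.map_id]
    exact e.inv_hom_id

/-- Isomorphisms of the stable category from morphisms of modules. -/
def stableIso {M N : GMod k p} (f : M ⟶ N) (g : N ⟶ M) (hfg : Null (f ≫ g - 𝟙 M))
    (hgf : Null (g ≫ f - 𝟙 N)) : (toStable k p).obj M ≅ (toStable k p).obj N where
  hom := (toStable k p).map f
  inv := (toStable k p).map g
  hom_inv_id := by
    rw [← Functor.map_comp, ← CategoryTheory.Functor.map_id, toStable_map_eq_iff]
    exact hfg
  inv_hom_id := by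
    rw [← Functor.map_comp, ← CategoryTheory.Functor.map_id, toStable_map_eq_iff]
    exact hgf

variable [Fact p.Prime] [CharP k p]

/-- The homomorphism from the Grothendieck group defined by the weighted dimension. -/
def wdimHom {G : Type*} [AddCommGroup G] (w : ℤ → G)
    (hw : ∀ i, ∑ j ∈ Finset.range p, w (i + j) = 0) : K0Stable k p →+ G :=
  QuotientAddGroup.lift _ (FreeAbelianGroup.lift fun M : StableCat k p => wdim w M.as) (by
    rw [AddSubgroup.closure_le]
    -- A distinguished triangle is termwise stably isomorphic to a standard one, and the weighted
    -- dimension is a stable invariant, so only cones have to be checked.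
    rintro _ ⟨t, ⟨s, ⟨X, Y, C, f, g, f', h, hpo, -, -, rfl⟩, a, b, c, -⟩, rfl⟩
    rw [SetLike.mem_coe, AddMonoidHom.mem_ker, map_sub, map_add, FreeAbelianGroup.lift_apply_of,
      FreeAbelianGroup.lift_apply_of, FreeAbelianGroup.lift_apply_of, wdim_of_stableIso w hw a,
      wdim_of_stableIso w hw b, wdim_of_stableIso w hw c, sub_eq_zero]
    exact wdim_cone w hw hpo)

theorem wdimHom_cls {G : Type*} [AddCommGroup G] (w : ℤ → G)
    (hw : ∀ i, ∑ j ∈ Finset.range p, w (i + j) = 0) (M : GMod k p) :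
    wdimHom w hw (cls M) = wdim w M := by
  change FreeAbelianGroup.lift (fun M : StableCat k p => wdim w M.as) (FreeAbelianGroup.of _) = _
  rw [FreeAbelianGroup.lift_apply_of]
  rfl

/-! ### Relations in the Grothendieck group -/

theorem integralEmb_comp_suspensionProj (X : GMod k p) :
    integralEmb X ≫ suspensionProj X = 0 := by
  refine hom_ext (LinearMap.ext fun x => ?_)
  change tmul ((projModSocle k p).toLin (integral k p)) x = 0
  have h : (projModSocle k p).toLin (integral k p) = 0 :=
    (Submodule.Quotient.mk_eq_zero _).2 (Submodule.mem_span_singleton_self _)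
  rw [h, zero_tmul]

/-- Distinguished triangles are closed under isomorphism, so the middle term may be replaced by a
stably isomorphic object. This freedom is what makes classes stable invariants in
`cls_of_stableIso`. -/
theorem cls_cone {X Y Y' C : GMod k p} {f : X ⟶ Y} {g : Y ⟶ C} {f' : cover X ⟶ C}
    (hpo : IsPushout f (integralEmb X) g f')
    (e : (toStable k p).obj Y ≅ (toStable k p).obj Y') : cls Y' = cls X + cls C := by
  have hz : f ≫ (0 : Y ⟶ (suspension k p).obj X) = integralEmb X ≫ suspensionProj X := by
    rw [integralEmb_comp_suspensionProj, Limits.comp_zero]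
  let t : Sextuple (stableT k p) :=
    { X := (toStable k p).obj X
      Y := (toStable k p).obj Y
      Z := (toStable k p).obj C
      u := (toStable k p).map f
      v := (toStable k p).map g
      w := (toStable k p).map (hpo.desc 0 (suspensionProj X) hz) }
  have ht : IsStandard t := ⟨X, Y, C, f, g, f', hpo.desc 0 (suspensionProj X) hz, hpo,
    hpo.inl_desc _ _ _, hpo.inr_desc _ _ _, rfl⟩
  let t' : Sextuple (stableT k p) :=
    { X := t.X
      Y := (toStable k p).obj Y'
      Z := t.Z
      u := t.u ≫ e.hom
      v := e.inv ≫ t.v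
      w := t.w }
  have ht' : IsDistinguished t' := by
    refine ⟨t, ht, Iso.refl _, e.symm, Iso.refl _, ?_, ?_, ?_⟩
    · simp [t', t]
    · simp [t']
    · simp [t']
  have hmem : FreeAbelianGroup.of t'.Y - (FreeAbelianGroup.of t'.X + FreeAbelianGroup.of t'.Z) ∈
      AddSubgroup.closure {x | ∃ t : Sextuple (stableT k p), IsDistinguished t ∧
        x = FreeAbelianGroup.of t.Y - (FreeAbelianGroup.of t.X + FreeAbelianGroup.of t.Z)} :=
    AddSubgroup.subset_closure ⟨t', ht', rfl⟩
  have h0 := (QuotientAddGroup.eq_zero_iff _).2 hmem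
  exact sub_eq_zero.1 h0

/-- The cover of $X$ is injective, so the embedding of $X$ into it extends along $u$ and the pushout
splits as $Z$ plus the cover. -/
theorem cls_cone_of_shortExact {X Y Y' Z : GMod k p} {u : X ⟶ Y} {v : Y ⟶ Z} (h : ShortExact u v)
    (e : (toStable k p).obj Y ≅ (toStable k p).obj Y') :
    cls Y' = cls X + cls (prod Z (cover X)) := by
  obtain ⟨s, hs⟩ := (hasDerivation_cover X).exists_extension h.inj (integralEmb X)
  exact cls_cone (h.isPushout _ s hs) e

/-- The generators are objects, not isomorphism classes. The sequence $0\to 0\to M\to M\to 0$ gives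
a triangle whose middle term may be taken to be $M$ or $N$ with the same outer terms. -/
theorem cls_of_stableIso {M N : GMod k p}
    (e : (toStable k p).obj M ≅ (toStable k p).obj N) : cls M = cls N := by
  have h := shortExact_of_iso (Iso.refl M)
  rw [cls_cone_of_shortExact h (Iso.refl _), cls_cone_of_shortExact h e]

theorem cls_of_iso {M N : GMod k p} (e : M ≅ N) : cls M = cls N :=
  cls_of_stableIso ((toStable k p).mapIso e)

theorem cls_prod_projective (M P : GMod k p) (hP : Module.Projective (H k p) P) :
    cls (prod M P) = cls M := by
  refine cls_of_stableIso (stableIso (fst M P) (inl M P) ?_ ?_)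
  · rw [← fst_inl_add_snd_inr, sub_add_cancel_left]
    exact ((null_of_projective hP _).comp_right _).neg
  · rw [inl_fst, sub_self]
    exact Null.zero

theorem cls_of_shortExact {X Y Z : GMod k p} {u : X ⟶ Y} {v : Y ⟶ Z} (h : ShortExact u v) :
    cls Y = cls X + cls Z := by
  rw [cls_cone_of_shortExact h (Iso.refl _), cls_prod_projective _ _ (projective_cover X)]

theorem cls_zeroObj : cls (zeroObj k p) = 0 := by
  have h := cls_of_shortExact (shortExact_of_iso (Iso.refl (zeroObj k p)))
  rwa [right_eq_add] at h

theorem cls_projective (P : GMod k p) (hP : Module.Projective (H k p) P) : cls P = 0 := by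
  rw [← cls_zeroObj (k := k) (p := p)]
  refine cls_of_stableIso (stableIso 0 0 ?_ ?_)
  · rw [Limits.comp_zero, zero_sub]
    exact (null_of_projective hP _).neg
  · rw [Limits.comp_zero, zero_sub]
    exact (null_of_projective projective_zeroObj _).neg

end StableLemmas

/-! ### Dimensions of shifts, tensor products and the unit object -/

section Dimensions

variable {k : Type u} [Field k] {p : ℕ}

namespace GMod

theorem wdim_shift {G : Type*} [AddCommGroup G] (w : ℤ → G) (M : GMod k p) (n : ℤ) :
    wdim w (M.shift n) = wdim (fun i => w (i + n)) M := by
  obtain ⟨ι, _, b, δ, hb⟩ := exists_homogeneous_basis M.isInternal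
  have h1 := weightedDim_of_basis (fun i => w (i + n)) M.isInternal b δ hb
  have h2 := weightedDim_of_basis w (M.shift n).isInternal b (fun i => δ i + n) (fun i => by
    change b i ∈ M.deg (δ i + n - n)
    rw [add_sub_cancel_right]
    exact hb i)
  exact h2.trans h1.symm

/-- Multiplication by $X$ raises degrees, so it kills the highest nonzero component. -/
theorem exists_socle_element (M : GMod k p) [Nontrivial M] :
    ∃ (n : ℤ) (v : M), v ∈ M.deg n ∧ xH k p • v = 0 ∧ v ≠ 0 := by
  have hne : {n | M.deg n ≠ ⊥}.Nonempty := by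
    by_contra h
    have h0 : ∀ n, M.deg n = ⊥ := fun n => by
      by_contra hn
      exact h ⟨n, hn⟩
    have htop := M.isInternal.submodule_iSup_eq_top
    rw [iSup_congr h0, iSup_bot] at htop
    exact bot_ne_top htop
  obtain ⟨n, hn, hmax⟩ := (finite_deg_ne_bot M.isInternal).exists_maximal hne
  obtain ⟨v, hv, hv0⟩ := (Submodule.ne_bot_iff _).1 hn
  refine ⟨n, v, hv, ?_, hv0⟩
  have h1 : M.deg (1 + n) = ⊥ := by
    by_contra h
    have := hmax (show (1 + n) ∈ {n | M.deg n ≠ ⊥} from h) (by omega)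
    omega
  have h2 := M.xH_smul_mem hv
  rw [h1] at h2
  exact (Submodule.mem_bot k).1 h2

/-- This is the descent for the induction on dimension in `cls_eq_wdim`. -/
theorem finrank_coker_lt {A B C : GMod k p} {f : A ⟶ B} {g : B ⟶ C} (h : ShortExact f g)
    [Nontrivial A] : Module.finrank k C < Module.finrank k B := by
  have h1 := g.toLinBase.finrank_range_add_finrank_ker
  rw [LinearMap.range_eq_top.2 (show Function.Surjective g.toLinBase from h.surj),
    finrank_top] at h1
  have h2 : 0 < Module.finrank k (LinearMap.ker g.toLinBase) := by
    obtain ⟨a, ha⟩ := exists_ne (0 : A)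
    rw [Module.finrank_pos_iff_exists_ne_zero]
    refine ⟨⟨f.toLin a, (h.exact _).2 ⟨a, rfl⟩⟩, fun h0 => ha (h.inj ?_)⟩
    rw [map_zero]
    exact congrArg Subtype.val h0
  omega

/-- The identity, between shifts of a module that agree. -/
def shiftIso (M : GMod k p) {a b c : ℤ} (h : a + b = c) : (M.shift a).shift b ≅ M.shift c where
  hom := ⟨LinearMap.id, fun i m hm => by
    change m ∈ M.deg (i - b - a) at hm
    change m ∈ M.deg (i - c)
    rwa [← h, add_comm, ← sub_sub]⟩
  inv := ⟨LinearMap.id, fun i m hm => by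
    change m ∈ M.deg (i - c) at hm
    change m ∈ M.deg (i - b - a)
    rwa [← h, add_comm, ← sub_sub] at hm⟩

/-- The shift by zero. -/
def shiftZeroIso (M : GMod k p) : M.shift 0 ≅ M where
  hom := ⟨LinearMap.id, fun i m hm => by
    change m ∈ M.deg (i - 0) at hm
    rwa [sub_zero] at hm⟩
  inv := ⟨LinearMap.id, fun i m hm => by
    change m ∈ M.deg (i - 0)
    rwa [sub_zero]⟩

variable [Fact p.Prime]

theorem wdim_regular {G : Type*} [AddCommGroup G] (w : ℤ → G) :
    wdim w (regular k p) = ∑ j ∈ Finset.range p, w j := by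
  obtain ⟨b, hb⟩ := exists_basis_H k p
  have h := weightedDim_of_basis w (regular k p).isInternal b (fun i => ((i : ℕ) : ℤ))
    (fun i => by
      have h := xH_pow_mem k p i
      rwa [← hb] at h)
  rw [wdim, h, Finset.sum_range]

variable [CharP k p]

theorem wdim_unit {G : Type*} [AddCommGroup G] (w : ℤ → G) : wdim w (unit k p) = w 0 := by
  have h := weightedDim_of_basis w (unit k p).isInternal (Module.Basis.singleton PUnit.{1} k)
    (fun _ => 0) (fun i => by
      change _ ∈ if (0 : ℤ) = 0 then (⊤ : Submodule k k) else ⊥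
      rw [if_pos rfl]
      exact Submodule.mem_top)
  rw [wdim, h]
  simp

theorem wdim_tensor {R : Type*} [CommRing R] (q : Rˣ) (M N : GMod k p) :
    wdim (fun n => ((q ^ n : Rˣ) : R)) (tensor M N) =
      wdim (fun n => ((q ^ n : Rˣ) : R)) M * wdim (fun n => ((q ^ n : Rˣ) : R)) N := by
  obtain ⟨ι, _, b, δ, hb⟩ := exists_homogeneous_basis M.isInternal
  obtain ⟨κ, _, c, ε, hc⟩ := exists_homogeneous_basis N.isInternal
  have h1 := weightedDim_of_basis (fun n => ((q ^ n : Rˣ) : R)) M.isInternal b δ hb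
  have h2 := weightedDim_of_basis (fun n => ((q ^ n : Rˣ) : R)) N.isInternal c ε hc
  have h3 := weightedDim_of_basis (fun n => ((q ^ n : Rˣ) : R)) (tensor M N).isInternal
    (b.tensorProduct c) (fun i => δ i.1 + ε i.2) (fun i => by
      have h : b.tensorProduct c i = b i.1 ⊗ₜ[k] c i.2 := Module.Basis.tensorProduct_apply' b c i
      exact Set.mem_of_eq_of_mem h (tmul_mem_tensorDeg rfl (hb _) (hc _)))
  rw [wdim, wdim, wdim, h1, h2, h3, Finset.sum_mul_sum, Fintype.sum_prod_type]
  simp only [zpow_add, Units.val_mul]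

/-- A homogeneous element killed by `X` spans a shifted copy of the unit object. -/
def unitMap {M : GMod k p} {n : ℤ} (v : M) (hv : v ∈ M.deg n) (hx : xH k p • v = 0) :
    (unit k p).shift n ⟶ M where
  toLin := linearOfX (show (unit k p).shift n →ₗ[k] M from LinearMap.toSpanSingleton k M v)
    (fun c => by
      have h0 : xH k p • c = 0 := by
        change counitH k p (xH k p) * (show k from c) = 0
        rw [counitH, xH, AdjoinRoot.liftAlgHom_root, zero_mul]
      rw [h0, map_zero]
      change (0 : M) = xH k p • (show k from c) • v
      rw [smul_comm, hx, smul_zero])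
  map_deg i c hc := by
    change (show k from c) • v ∈ M.deg i
    change c ∈ (if i - n = 0 then ⊤ else ⊥ : Submodule k k) at hc
    split_ifs at hc with h
    · rw [sub_eq_zero.1 h]
      exact Submodule.smul_mem _ _ hv
    · have hc' : (show k from c) = 0 := (Submodule.mem_bot k).1 hc
      rw [hc', zero_smul]
      exact Submodule.zero_mem _

end GMod

open GMod

variable [Fact p.Prime] [CharP k p]

/-! ### Classes of the shifted unit object and the map from $\mathbb Z[q]$ -/

variable (k p) in
/-- The class of the unit object in degree `n`. -/
def unitCls (n : ℤ) : K0Stable k p := cls ((unit k p).shift n)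

theorem wdim_unit_shift {G : Type*} [AddCommGroup G] (w : ℤ → G) (n : ℤ) :
    wdim w ((unit k p).shift n) = w n := by
  rw [wdim_shift, wdim_unit, zero_add]

/-- The class of a module is the sum of the classes of its composition factors. -/
theorem cls_eq_wdim (M : GMod k p) : cls M = wdim (unitCls k p) M := by
  induction hd : Module.finrank k M using Nat.strong_induction_on generalizing M with
  | _ d ih =>
    rcases subsingleton_or_nontrivial M with hM | hM
    · have : Module.Projective (H k p) M := inferInstance
      rw [wdim_of_subsingleton, cls_projective M this]
    -- Split off a copy of $k\{n\}$ in the socle; both sides are additive, and the quotient has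
    -- smaller dimension.
    · obtain ⟨n, v, hv, hx, hv0⟩ := M.exists_socle_element
      have hse : ShortExact (unitMap v hv hx) (cokerProj (unitMap v hv hx)) :=
        { toRightExact := rightExact_coker _
          inj := fun a b hab => smul_left_injective k hv0 hab }
      have : Nontrivial ((unit k p).shift n) := inferInstanceAs (Nontrivial k)
      have hlt := finrank_coker_lt hse
      rw [hd] at hlt
      rw [cls_of_shortExact hse, hse.wdim_eq, wdim_unit_shift, ih _ hlt _ rfl]
      rfl

/-- The module $H\{i\}$ is projective, so its class is zero, while its basis $1,X,\dots,X^{p-1}$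
occupies the degrees $i,\dots,i+p-1$. -/
theorem sum_unitCls (i : ℤ) : ∑ j ∈ Finset.range p, unitCls k p (i + j) = 0 := by
  have hP : Module.Projective (H k p) ((regular k p).shift i) :=
    inferInstanceAs (Module.Projective (H k p) (H k p))
  have h := cls_projective _ hP
  rw [cls_eq_wdim, wdim_shift, wdim_regular] at h
  rw [← h]
  exact Finset.sum_congr rfl fun j _ => by rw [add_comm]

/-- Dropping the last or the first of $p+1$ consecutive terms leaves a sum equal to zero, so these
two terms agree. -/
theorem unitCls_periodic : Function.Periodic (unitCls k p) p := by
  intro i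
  have h1 := Finset.sum_range_succ (fun j : ℕ => unitCls k p (i + j)) p
  have h2 := Finset.sum_range_succ' (fun j : ℕ => unitCls k p (i + j)) p
  have h3 : ∑ j ∈ Finset.range p, unitCls k p (i + ((j + 1 : ℕ) : ℤ)) = 0 := by
    rw [← sum_unitCls (k := k) (p := p) (i + 1)]
    exact Finset.sum_congr rfl fun j _ => by rw [Nat.cast_succ, add_assoc, add_comm (1 : ℤ)]
  rw [sum_unitCls, zero_add] at h1
  rw [h3, h1, zero_add, Nat.cast_zero, add_zero] at h2
  exact h2

variable (k p) in
/-- The additive map `ℤ[q] → K` sending `q ^ n` to the class of the unit object in degree `n`. -/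
def polyToK : Polynomial ℤ →ₗ[ℤ] K0Stable k p :=
  Polynomial.lsum fun n => LinearMap.toSpanSingleton ℤ _ (unitCls k p n)

theorem polyToK_monomial (n : ℕ) (a : ℤ) :
    polyToK k p (Polynomial.monomial n a) = a • unitCls k p n := by
  rw [polyToK, Polynomial.lsum_apply, Polynomial.sum_monomial_index _ _ (by simp)]
  rfl

/-- Polynomials have only nonnegative exponents; by periodicity, adding $|n|p\ge|n|$ to $n$ reaches
one without changing the class. -/
theorem unitCls_mem_range (n : ℤ) : unitCls k p n ∈ LinearMap.range (polyToK k p) := by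
  have h1 : unitCls k p (n + n.natAbs * p) = unitCls k p n := unitCls_periodic.nat_mul n.natAbs n
  have hp := (Fact.out : p.Prime).one_le
  have h2 : 0 ≤ n + n.natAbs * p := by
    have : (n.natAbs : ℤ) * 1 ≤ n.natAbs * p := by gcongr; exact_mod_cast hp
    omega
  obtain ⟨m, hm⟩ := Int.eq_ofNat_of_zero_le h2
  refine ⟨Polynomial.monomial m 1, ?_⟩
  rw [polyToK_monomial, one_smul, ← h1, hm]

theorem polyToK_surjective : Function.Surjective (polyToK k p) := by
  intro x
  change x ∈ LinearMap.range (polyToK k p)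
  obtain ⟨x, rfl⟩ := QuotientAddGroup.mk_surjective x
  induction x using FreeAbelianGroup.induction_on with
  | zero => exact Submodule.zero_mem _
  | of M =>
    change cls M.as ∈ _
    obtain ⟨ι, _, b, δ, hb⟩ := exists_homogeneous_basis M.as.isInternal
    rw [cls_eq_wdim, wdim, weightedDim_of_basis _ M.as.isInternal b δ hb]
    exact Submodule.sum_mem _ fun i _ => unitCls_mem_range _
  | neg M hM => exact Submodule.neg_mem _ hM
  | add a b ha hb => exact Submodule.add_mem _ ha hb

/-- As `polyToK` is only known to be additive, vanishing has to be checked on the whole ideal, not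
just on its generator. -/
theorem polyToK_mul (f : Polynomial ℤ) :
    polyToK k p ((∑ i ∈ Finset.range p, Polynomial.X ^ i) * f) = 0 := by
  induction f using Polynomial.induction_on' with
  | add f g hf hg => rw [mul_add, map_add, hf, hg, add_zero]
  | monomial n a =>
    rw [Finset.sum_mul, map_sum]
    have h : ∀ i ∈ Finset.range p, polyToK k p (Polynomial.X ^ i * Polynomial.monomial n a) =
        a • unitCls k p (n + i) := by
      intro i _
      rw [mul_comm, Polynomial.monomial_mul_X_pow, polyToK_monomial, Nat.cast_add]
    rw [Finset.sum_congr rfl h, ← Finset.smul_sum, sum_unitCls, smul_zero]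

end Dimensions

/-! ### The ring `R_p` -/

section Ring

variable (p : ℕ)

theorem CycloRing.sum_q_pow : ∑ i ∈ Finset.range p, CycloRing.q p ^ i = 0 := by
  have h := AdjoinRoot.mk_self (f := (∑ i ∈ Finset.range p, Polynomial.X ^ i : Polynomial ℤ))
  rw [map_sum] at h
  simp only [map_pow, AdjoinRoot.mk_X] at h
  exact h

/-- Multiply the defining relation by $q-1$. This makes $q$ invertible, so negative degrees have a
weight too. -/
theorem CycloRing.q_pow : CycloRing.q p ^ p = 1 := by
  have h := mul_geom_sum (CycloRing.q p) p
  rw [sum_q_pow, mul_zero] at h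
  exact (sub_eq_zero.1 h.symm)

/-- The class of `q`, as a unit. -/
def CycloRing.qUnit [Fact p.Prime] : (CycloRing p)ˣ :=
  Units.ofPowEqOne (CycloRing.q p) p (CycloRing.q_pow p) (Fact.out : p.Prime).ne_zero

theorem CycloRing.sum_qUnit [Fact p.Prime] (i : ℤ) :
    ∑ j ∈ Finset.range p, ((CycloRing.qUnit p ^ (i + j) : (CycloRing p)ˣ) : CycloRing p) = 0 := by
  have h : ∀ j ∈ Finset.range p,
      ((CycloRing.qUnit p ^ (i + j) : (CycloRing p)ˣ) : CycloRing p) =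
        ((CycloRing.qUnit p ^ i : (CycloRing p)ˣ) : CycloRing p) * CycloRing.q p ^ j := by
    intro j _
    rw [zpow_add, zpow_natCast, Units.val_mul, Units.val_pow_eq_pow_val]
    rfl
  rw [Finset.sum_congr rfl h, ← Finset.mul_sum, sum_q_pow, mul_zero]

end Ring

/-! ### The Grothendieck group of the stable category -/

section Grothendieck

open GMod

variable (k : Type u) [Field k] (p : ℕ) [Fact p.Prime] [CharP k p]

/-- The graded dimension, with values in `R_p`. -/
def gradedDim : K0Stable k p →+ CycloRing p :=
  wdimHom (fun n => ((CycloRing.qUnit p ^ n : (CycloRing p)ˣ) : CycloRing p))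
    (CycloRing.sum_qUnit p)

theorem gradedDim_unit : gradedDim k p (cls (unit k p)) = 1 := by
  rw [gradedDim, wdimHom_cls, wdim_unit, zpow_zero, Units.val_one]

theorem gradedDim_tensor (M N : GMod k p) : gradedDim k p (cls (tensor M N)) =
    gradedDim k p (cls M) * gradedDim k p (cls N) := by
  rw [gradedDim, wdimHom_cls, wdimHom_cls, wdimHom_cls, wdim_tensor]

theorem gradedDim_shift (M : GMod k p) :
    gradedDim k p (cls (M.shift 1)) = CycloRing.q p * gradedDim k p (cls M) := by
  obtain ⟨ι, _, b, δ, hb⟩ := exists_homogeneous_basis M.isInternal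
  rw [gradedDim, wdimHom_cls, wdimHom_cls, wdim_shift, wdim, wdim,
    weightedDim_of_basis _ M.isInternal b δ hb, weightedDim_of_basis _ M.isInternal b δ hb,
    Finset.mul_sum]
  refine Finset.sum_congr rfl fun i _ => ?_
  rw [zpow_add_one, Units.val_mul, mul_comm]
  rfl

variable {k p}

/-- Additive maps compatible with the unit object and the shift are determined. -/
theorem map_polyToK (φ : K0Stable k p →+ CycloRing p) (h1 : φ (cls (unit k p)) = 1)
    (hq : ∀ M : GMod k p, φ (cls (M.shift 1)) = CycloRing.q p * φ (cls M)) (f : Polynomial ℤ) :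
    φ (polyToK k p f) = AdjoinRoot.mk _ f := by
  have hn : ∀ n : ℕ, φ (unitCls k p n) = CycloRing.q p ^ n := by
    intro n
    induction n with
    | zero => rw [unitCls, Nat.cast_zero, cls_of_iso (shiftZeroIso _), h1, pow_zero]
    | succ n ih =>
      rw [unitCls, ← cls_of_iso (shiftIso (unit k p) (Nat.cast_succ n).symm), hq, pow_succ', ← ih]
      rfl
  induction f using Polynomial.induction_on' with
  | add f g hf hg => rw [map_add, map_add, map_add, hf, hg]
  | monomial n a =>
    rw [polyToK_monomial, map_zsmul, hn, ← Polynomial.C_mul_X_pow_eq_monomial, map_mul, map_pow,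
      AdjoinRoot.mk_X, zsmul_eq_mul, eq_intCast Polynomial.C, map_intCast]
    rfl

theorem gradedDim_polyToK (f : Polynomial ℤ) :
    gradedDim k p (polyToK k p f) = AdjoinRoot.mk _ f :=
  map_polyToK _ (gradedDim_unit k p) (gradedDim_shift k p) f

variable (k p)

/-- The composite with the surjection `polyToK` is the quotient map $\mathbb Z[q]\to R_p$, and
`polyToK` already kills the kernel of that map. -/
theorem gradedDim_bijective : Function.Bijective (gradedDim k p) := by
  constructor
  · rw [injective_iff_map_eq_zero]
    intro x hx
    obtain ⟨f, rfl⟩ := polyToK_surjective x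
    rw [gradedDim_polyToK, AdjoinRoot.mk_eq_zero] at hx
    obtain ⟨h, rfl⟩ := hx
    exact polyToK_mul h
  · intro y
    obtain ⟨f, rfl⟩ := AdjoinRoot.mk_surjective y
    exact ⟨polyToK k p f, gradedDim_polyToK f⟩

end Grothendieck

end KStable

end

/-- The Grothendieck group of the stable category of finite-dimensional graded `H`-modules is
isomorphic to `R_p`, by a unique additive isomorphism that takes the class of the unit object to
`1`, tensor products to products and the grading shift `{1}` to multiplication by `q`. -/
theorem mainTheorem4 (p : ℕ) [Fact p.Prime] (k : Type u) [Field k] [CharP k p] :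
    ∃! φ : KStable.K0Stable k p ≃+ KStable.CycloRing p,
      φ (KStable.cls (KStable.GMod.unit k p)) = 1 ∧
      (∀ M N : KStable.GMod k p,
        φ (KStable.cls (KStable.GMod.tensor M N)) = φ (KStable.cls M) * φ (KStable.cls N)) ∧
      (∀ M : KStable.GMod k p,
        φ (KStable.cls (M.shift 1)) = KStable.CycloRing.q p * φ (KStable.cls M)) := by
  refine ⟨AddEquiv.ofBijective (KStable.gradedDim k p) (KStable.gradedDim_bijective k p),
    ⟨KStable.gradedDim_unit k p, KStable.gradedDim_tensor k p, KStable.gradedDim_shift k p⟩, ?_⟩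
  -- The values on the unit object and its shifts determine $\varphi$ on the image of `polyToK`,
  -- which is the whole group.
  rintro φ ⟨h1, -, hq⟩
  ext x
  obtain ⟨f, rfl⟩ := KStable.polyToK_surjective x
  exact (KStable.map_polyToK φ.toAddMonoidHom h1 hq f).trans (KStable.gradedDim_polyToK f).symm
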